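/- Let $V=\bigcup_n V_n$ be the superstructure over $\mathbb N$, where the natural numbers are urelements, $V_0=\mathbb N$ and $V_{n+1}=V_n\cup\mathcal P(V_n)$. Let ${}^*V$ be a nonstandard universe: for some elementary extension $(W,E)$ of $(V,\in)$, with elementary embedding $x\mapsto{}^*x$ and ${}^*\mathbb N\smallsetminus\mathbb N\neq\emptyset$, ${}^*V$ consists of the elements of $W$ that belong to some ${}^*V_n$, $n\in\mathbb N$. The elements of ${}^*V$ that are sets in the sense of $W$ are called internal sets. ${}^*V$ is $\kappa$-saturated if every family of fewer than $\kappa$ internal sets with the finite intersection property has non-empty intersection. Given $H\in{}^*\mathbb N\smallsetminus\mathbb N$, let $\Omega=\{1,2,\dots,H\}$; the hyperfinite Loeb space $(\Omega,\Sigma,L_P)$ is the complete probability space obtained by the Carathéodory extension from the finitely additive measure $A\mapsto \mathrm{st}({}^*|A|/H)$ on the algebra of internal subsets $A$ of $\Omega$, where ${}^*|A|$ is the internal cardinality. A probability space $(\Omega,\Sigma,P)$ is compact if there is a family $\mathcal C\subseteq\Sigma$ such that every $\mathcal D\subseteq\mathcal C$ with the finite intersection property has $\bigcap\mathcal D\ne\emptyset$,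 and $P(A)=\sup\{P(C):C\in\mathcal C,\ C\subseteq A\}$ for every $A\in\Sigma$. Corollary 4. Suppose every set $S\subseteq 2^{\omega}$ with $|S|<2^\omega$ is null for the fair-coin product measure on $2^\omega$. Suppose ${}^*V$ is $2^\omega$-saturated and $|{}^*\mathbb N|=2^\omega$. Then every hyperfinite Loeb space in ${}^*V$ is compact. -/

import Mathlib

open MeasureTheory Cardinal

universe u

/-! The superstructure over the natural numbers, taken as urelements (atoms). -/

/-- The cumulative levels: `V_0 = ℕ` and `V_{n+1} = ℕ ∪ 𝒫(V_n)`. As every set in `V_n` is a subset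
of `V_n`, this is the same as `V_{n+1} = V_n ∪ 𝒫(V_n)`. -/
def VLevel : ℕ → Type
  | 0 => ℕ
  | n + 1 => ℕ ⊕ Set (VLevel n)

/-- The number `k`, as an atom in `V_0`. -/
def VLevel.nat (k : ℕ) : VLevel 0 := k

/-- A subset of `V_n`, as an element of `V_{n+1}`. -/
def VLevel.set {n : ℕ} (S : Set (VLevel n)) : VLevel (n + 1) := Sum.inr S

/-- The inclusion `V_n ⊆ V_{n+1}`: atoms go to themselves, a set goes to the set of the images of
its elements. -/
def VLevel.incl : (n : ℕ) → VLevel n → VLevel (n + 1)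
  | 0 => fun k => Sum.inl k
  | n + 1 => fun x => Sum.map id (fun S => VLevel.incl n '' S) x

/-- The inclusion `V_n ⊆ V_m` for `n ≤ m`. -/
def VLevel.up {n m : ℕ} (h : n ≤ m) (a : VLevel n) : VLevel m :=
  Nat.leRecOn h (fun {k} => VLevel.incl k) a

theorem VLevel.up_up {n m k : ℕ} (h₁ : n ≤ m) (h₂ : m ≤ k) (a : VLevel n) :
    VLevel.up h₂ (VLevel.up h₁ a) = VLevel.up (h₁.trans h₂) a :=
  (Nat.leRecOn_trans h₁ h₂ a).symm

/-- Elements of two levels are identified when they agree in some common higher level. -/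
def VSetoid : Setoid (Σ n, VLevel n) where
  r x y := ∃ (k : ℕ) (hx : x.1 ≤ k) (hy : y.1 ≤ k), VLevel.up hx x.2 = VLevel.up hy y.2
  iseqv :=
    { refl := fun x => ⟨x.1, le_rfl, le_rfl, rfl⟩
      symm := fun ⟨k, hx, hy, h⟩ => ⟨k, hy, hx, h.symm⟩
      trans := by
        rintro x y z ⟨k, hx, hy, h⟩ ⟨l, hy', hz, h'⟩
        refine ⟨max k l, hx.trans (le_max_left _ _), hz.trans (le_max_right _ _), ?_⟩
        rw [← VLevel.up_up hx (le_max_left k l), h, VLevel.up_up, ← VLevel.up_up hz (le_max_right k l),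
          ← h', VLevel.up_up] }

/-- The standard universe `V = ⋃ n, V_n`. -/
def StdV : Type := Quotient VSetoid

namespace StdV

/-- The element of `V` given by an element of `V_n`. -/
def mk (n : ℕ) (a : VLevel n) : StdV := Quotient.mk VSetoid ⟨n, a⟩

/-- A natural number as an atom of `V`. -/
def atom (k : ℕ) : StdV := mk 0 (VLevel.nat k)

/-- The set `S ∩ V_n`, an element of `𝒫(V_n) ⊆ V_{n+1}`. -/
def ofSet (n : ℕ) (S : Set StdV) : StdV := mk (n + 1) (VLevel.set {a : VLevel n | mk n a ∈ S})

/-- The level `V_n`, as an element of `V`. -/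
def level (n : ℕ) : StdV := ofSet n Set.univ

/-- Membership in `V`: `x` belongs to `y` iff `y` is a set `S ⊆ V_n`, for some `n`, and `x` is in
`S`. Atoms have no elements. -/
def Mem (x y : StdV) : Prop :=
  ∃ (n : ℕ) (a : VLevel n) (S : Set (VLevel n)), x = mk n a ∧ y = mk (n + 1) (VLevel.set S) ∧ a ∈ S

end StdV

/-! The first-order language with one binary relation symbol. -/

/-- The only relation symbol is the binary membership symbol. -/
inductive MemSymbol : ℕ → Type
  | mem : MemSymbol 2

/-- The first-order language of membership. -/
def memLang : FirstOrder.Language.{0, 0} where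
  Functions := fun _ => Empty
  Relations := MemSymbol

/-- The membership relation of a structure. -/
def Elem {M : Type*} [memLang.Structure M] (x y : M) : Prop :=
  FirstOrder.Language.Structure.RelMap (L := memLang) MemSymbol.mem ![x, y]

infix:50 " ε " => Elem

/-- The standard universe `(V, ∈)` as a structure. -/
instance StdV.structure : memLang.Structure StdV where
  funMap := fun f => Empty.elim f
  RelMap := fun r v => match r, v with
    | MemSymbol.mem, v => StdV.Mem (v 0) (v 1)

section Pairs

variable {M : Type*} [memLang.Structure M]

/-- `z = {x, y}`. -/
def IsUPair (z x y : M) : Prop := ∀ w, w ε z ↔ w = x ∨ w = y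

/-- `p = (x, y)`, the Kuratowski pair `{{x}, {x, y}}`. -/
def IsOPair (p x y : M) : Prop := ∃ s t, IsUPair s x x ∧ IsUPair t x y ∧ IsUPair p s t

/-- `(x, y) ∈ c`. -/
def RelHolds (c x y : M) : Prop := ∃ p, IsOPair p x y ∧ p ε c

end Pairs

namespace StdV

/-- The set of all pairs `(x, y) ∈ V_n` with `R x y`, as an element of `V`. -/
def graph (n : ℕ) (R : StdV → StdV → Prop) : StdV :=
  ofSet n {p | ∃ x y, IsOPair p x y ∧ R x y}

/-- The usual order of `ℕ`, as an element of `V` (pairs of atoms are in `V_2`). -/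
def natLE : StdV := graph 2 fun x y => ∃ i j : ℕ, x = atom i ∧ y = atom j ∧ i ≤ j

/-- For `p q : ℕ`, the relation `p / q ≤ i / j`, that is `p * j ≤ q * i`, between natural
numbers `i` and `j`, as an element of `V`. -/
def ratioGE (p q : ℕ) : StdV := graph 2 fun x y => ∃ i j : ℕ, x = atom i ∧ y = atom j ∧ p * j ≤ q * i

/-- The cardinality function on finite sets of natural numbers, as an element of `V` (the pairs
`(F, |F|)` are in `V_3`). -/
def finCard : StdV :=
  graph 3 fun x y => ∃ F : Finset ℕ, x = ofSet 0 (atom '' (F : Set ℕ)) ∧ y = atom F.card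

end StdV

/-- A nonstandard universe. It is given by an elementary extension `Carrier` of the standard
universe `(V, ∈)`, in which `*ℕ` has an element outside `ℕ`; the universe `*V` itself is the
truncation `starV` of `Carrier` below. -/
structure NonstandardUniverse where
  /-- the elementary extension, before truncation -/
  Carrier : Type u
  /-- its membership relation -/
  [str : memLang.Structure Carrier]
  /-- the map `x ↦ *x` -/
  star : FirstOrder.Language.ElementaryEmbedding memLang StdV Carrier
  /-- `*ℕ ∖ ℕ ≠ ∅` -/
  exists_nonstandard : ∃ x : Carrier, x ε star (StdV.level 0) ∧ ∀ k : ℕ, x ≠ star (StdV.atom k)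

namespace NonstandardUniverse

attribute [instance] NonstandardUniverse.str

variable (U : NonstandardUniverse.{u})

/-- `*V`, the elements of finite rank in the elementary extension: those that belong to `*V_n` for
some standard `n`. -/
def starV : Set U.Carrier := {x | ∃ n : ℕ, x ε U.star (StdV.level n)}

/-- The set `*ℕ`. -/
def starNat : Set U.Carrier := {x | x ε U.star (StdV.level 0)}

/-- The hyperfinite integers: the elements of `*ℕ ∖ ℕ`. -/
def IsHyperfinite (H : U.Carrier) : Prop :=
  H ∈ U.starNat ∧ ∀ k : ℕ, H ≠ U.star (StdV.atom k)

/-- `*V` is `κ`-saturated: every family of fewer than `κ` internal sets (elements of `*V`) with the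
finite intersection property has non-empty intersection. -/
def IsSaturated (κ : Cardinal.{u}) : Prop :=
  ∀ F : Set U.Carrier, F ⊆ U.starV → #F < κ →
    (∀ G : Set U.Carrier, G ⊆ F → G.Finite → ∃ x ∈ U.starV, ∀ a ∈ G, x ε a) →
    ∃ x ∈ U.starV, ∀ a ∈ F, x ε a

/-- The sample space `Ω = {1, 2, …, H}`. -/
def Omega (H : U.Carrier) : Type u :=
  {x : U.Carrier // x ∈ U.starNat ∧ RelHolds (U.star StdV.natLE) (U.star (StdV.atom 1)) x ∧
    RelHolds (U.star StdV.natLE) x H}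

/-- `h = *|a|` for an internal, internally finite set `a ⊆ *ℕ`. -/
def IsInternalCard (a h : U.Carrier) : Prop := RelHolds (U.star StdV.finCard) a h

/-- The standard part of the quotient `h / k` of `h k ∈ *ℕ`, as the supremum of the standard
rational numbers `p / q` with `p / q ≤ h / k`. -/
noncomputable def stRatio (h k : U.Carrier) : ENNReal :=
  ⨆ (p : ℕ) (q : ℕ) (_ : 0 < q ∧ RelHolds (U.star (StdV.ratioGE p q)) h k), (p : ENNReal) / q

variable {U}

/-- The premeasure `S ↦ st (*|S| / H)` for internal sets `S ⊆ Ω`; its value is `∞` at sets that are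
not internal. -/
noncomputable def loebPre (H : U.Carrier) (S : Set (U.Omega H)) : ENNReal :=
  ⨅ (a : U.Carrier) (h : U.Carrier)
    (_ : {x | x ε a} = Subtype.val '' S ∧ U.IsInternalCard a h), U.stRatio h H

/-- The outer measure of the Carathéodory construction: the infimum of the sums of the premeasure
over countable covers by internal sets. -/
noncomputable def loebOuter (H : U.Carrier) : OuterMeasure (U.Omega H) :=
  OuterMeasure.boundedBy (loebPre H)

/-- The Loeb `σ`-algebra on `Ω`: the complete `σ`-algebra of the Carathéodory extension. -/
noncomputable instance loebSpace (H : U.Carrier) : MeasurableSpace (U.Omega H) :=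
  (loebOuter H).caratheodory

/-- The Loeb measure on `Ω`: the complete countably additive extension of the premeasure. -/
noncomputable def loebMeasure (H : U.Carrier) : Measure (U.Omega H) :=
  (loebOuter H).toMeasure le_rfl

end NonstandardUniverse

/-- The finite intersection property. -/
def HasFIP {α : Type*} (D : Set (Set α)) : Prop :=
  ∀ G : Set (Set α), G ⊆ D → G.Finite → (⋂₀ G).Nonempty

/-- A family of sets is compact if each of its subfamilies with the finite intersection property
has non-empty intersection. -/
def IsCompactFamily {α : Type*} (C : Set (Set α)) : Prop :=
  ∀ D : Set (Set α), D ⊆ C → HasFIP D → (⋂₀ D).Nonempty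

/-- A compact probability space: one with an inner-regular compact family of measurable sets. -/
def IsCompactProbabilitySpace {α : Type*} [MeasurableSpace α] (μ : Measure α) : Prop :=
  IsProbabilityMeasure μ ∧
    ∃ C : Set (Set α), (∀ K ∈ C, MeasurableSet K) ∧ IsCompactFamily C ∧
      ∀ A : Set α, MeasurableSet A → IsLUB {r | ∃ K ∈ C, K ⊆ A ∧ r = μ K} (μ A)

/-- The fair-coin product measure on `2^ω`. -/
noncomputable def cantorMeasure : Measure (ℕ → Bool) :=
  Measure.infinitePi fun _ => (PMF.uniformOfFintype Bool).toMeasure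

/-! The standard-index binary digits of a point of `Ω` define a map `Omega.bits` from `Ω` to `2^ω`.
A standard set of naturals with asymptotic density `d` has a trace on `Ω` of Loeb measure `d`
(`loebPre_of_density`), and sets given by finitely many digits are periodic. Hence the Loeb measure
is carried to the fair-coin measure (`map_bits_loebMeasure`).

Every measurable set is approximated from inside by countable intersections of internal sets
(`exists_iInter_internal_subset`). Internal subsets of `Ω` inject into `*ℕ`, so there are at most
`𝔠` sequences of them. Pairs `d` of such a sequence and a natural number are injected by `j` into
`2^ω`, which is well-ordered so that each proper initial segment has fewer than `𝔠` elements. The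
segment below `j d` is therefore null, and some closed `P d` avoids it with complement of measure at
most `1 / d.2`. The compact family consists of the intersections coded by `d`, cut down by the
preimage of `P d`. A given digit sequence lies in fewer than `𝔠` of the `P d`.

For compactness (`isCompactFamily_range`), extend a subfamily with the finite intersection property
to an ultrafilter and let `p` be the limit of the digits along it. Each closed set involved contains
`p`, so fewer than `𝔠` indices are involved. Saturation now applies to all the internal sets they
use together with the countably many conditions "digit `i` equals `p i`". The point it yields lies
in every member of the subfamily. -/

namespace StdV

/-! ### Membership and ordered pairs in the superstructure -/

theorem incl_injective (n : ℕ) : Function.Injective (VLevel.incl n) := by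
  induction n with
  | zero => exact fun a b h => Sum.inl.inj h
  | succ n ih => exact Function.Injective.sumMap Function.injective_id ih.image_injective

theorem up_succ {n m : ℕ} (h : n ≤ m) (a : VLevel n) :
    VLevel.up (h.trans m.le_succ) a = VLevel.incl m (VLevel.up h a) :=
  Nat.leRecOn_succ h a

theorem up_self {n : ℕ} (h : n ≤ n) (a : VLevel n) : VLevel.up h a = a :=
  Nat.leRecOn_self a

theorem up_injective {n m : ℕ} (h : n ≤ m) : Function.Injective (VLevel.up h) := by
  induction m, h using Nat.le_induction with
  | base => intro a b hab; simpa [up_self] using hab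
  | succ m h ih =>
    intro a b hab
    rw [up_succ h, up_succ h] at hab
    exact ih (incl_injective m hab)

theorem mk_up {n m : ℕ} (h : n ≤ m) (a : VLevel n) : mk m (VLevel.up h a) = mk n a :=
  Quotient.sound ⟨m, le_rfl, h, up_self _ _⟩

theorem mk_injective (n : ℕ) : Function.Injective (mk n) := by
  intro a b h
  obtain ⟨k, hx, hy, h⟩ := Quotient.exact h
  exact up_injective hx h

theorem up_set {n m : ℕ} (h : n ≤ m) (S : Set (VLevel n)) :
    VLevel.up (Nat.succ_le_succ h) (VLevel.set S) = VLevel.set (VLevel.up h '' S) := by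
  induction m, h using Nat.le_induction with
  | base =>
    rw [up_self]
    congr 1
    ext x
    simp [up_self]
  | succ m h ih =>
    rw [up_succ (Nat.succ_le_succ h), ih]
    change VLevel.set (VLevel.incl m '' (VLevel.up h '' S)) = _
    rw [Set.image_image]
    simp only [up_succ h]

theorem mk_set_up {n m : ℕ} (h : n ≤ m) (S : Set (VLevel n)) :
    mk (m + 1) (VLevel.set (VLevel.up h '' S)) = mk (n + 1) (VLevel.set S) := by
  rw [← up_set h, mk_up]

theorem set_injective {n : ℕ} : Function.Injective (VLevel.set (n := n)) :=
  fun _ _ h => Sum.inr.inj h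

/-- A witness of membership may represent the same set at another level `m`. Both representations
are moved to level `max n m`, where they agree because inclusions are injective. -/
theorem elem_mk_set {n : ℕ} {x : StdV} {S : Set (VLevel n)} :
    x ε mk (n + 1) (VLevel.set S) ↔ ∃ a ∈ S, x = mk n a := by
  constructor
  · rintro ⟨m, b, T, hx, hS, hb⟩
    change mk (n + 1) (VLevel.set S) = _ at hS
    change x = _ at hx
    rw [← mk_set_up (le_max_left n m), ← mk_set_up (le_max_right n m)] at hS
    have h := set_injective (mk_injective _ hS)
    have hb' : VLevel.up (le_max_right n m) b ∈ VLevel.up (le_max_left n m) '' S :=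
      h ▸ Set.mem_image_of_mem _ hb
    obtain ⟨a, ha, hab⟩ := hb'
    refine ⟨a, ha, ?_⟩
    rw [hx, ← mk_up (le_max_left n m) a, hab, mk_up]
  · rintro ⟨a, ha, hx⟩
    exact ⟨n, a, S, hx, rfl, ha⟩

theorem elem_ofSet {n : ℕ} {x : StdV} {S : Set StdV} :
    x ε ofSet n S ↔ x ∈ S ∧ x ∈ Set.range (mk n) := by
  rw [ofSet, elem_mk_set]
  constructor
  · rintro ⟨a, ha, rfl⟩
    exact ⟨ha, a, rfl⟩
  · rintro ⟨ha, a, rfl⟩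
    exact ⟨a, ha, rfl⟩

theorem range_mk_mono {n m : ℕ} (h : n ≤ m) : Set.range (mk n) ⊆ Set.range (mk m) := by
  rintro _ ⟨a, rfl⟩
  exact ⟨_, mk_up h a⟩

theorem atom_injective : Function.Injective atom := fun _ _ h => mk_injective 0 h

theorem atom_mem_range (n k : ℕ) : atom k ∈ Set.range (mk n) :=
  range_mk_mono (Nat.zero_le n) ⟨_, rfl⟩

theorem elem_level_zero {x : StdV} : x ε level 0 ↔ ∃ k, x = atom k := by
  rw [level, elem_ofSet]
  exact ⟨fun ⟨_, a, h⟩ => ⟨a, h.symm⟩, fun ⟨k, h⟩ => ⟨trivial, k, h.symm⟩⟩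

/-- A set of natural numbers, as an element of `V`. -/
def natSet (A : Set ℕ) : StdV := ofSet 0 (atom '' A)

theorem elem_natSet {x : StdV} {A : Set ℕ} : x ε natSet A ↔ ∃ k ∈ A, x = atom k := by
  rw [natSet, elem_ofSet]
  constructor
  · rintro ⟨⟨k, hk, rfl⟩, -⟩
    exact ⟨k, hk, rfl⟩
  · rintro ⟨k, hk, rfl⟩
    exact ⟨⟨k, hk, rfl⟩, atom_mem_range 0 k⟩

theorem atom_elem_natSet {k : ℕ} {A : Set ℕ} : atom k ε natSet A ↔ k ∈ A := by
  rw [elem_natSet]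
  exact ⟨fun ⟨j, hj, h⟩ => atom_injective h ▸ hj, fun h => ⟨k, h, rfl⟩⟩

theorem exists_isUPair {n : ℕ} {x y : StdV} (hx : x ∈ Set.range (mk n))
    (hy : y ∈ Set.range (mk n)) : ∃ z ∈ Set.range (mk (n + 1)), IsUPair z x y := by
  obtain ⟨a, rfl⟩ := hx
  obtain ⟨b, rfl⟩ := hy
  refine ⟨mk (n + 1) (VLevel.set {a, b}), ⟨_, rfl⟩, fun w => ?_⟩
  rw [elem_mk_set]
  simp

theorem exists_isOPair {n : ℕ} {x y : StdV} (hx : x ∈ Set.range (mk n))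
    (hy : y ∈ Set.range (mk n)) : ∃ z ∈ Set.range (mk (n + 2)), IsOPair z x y := by
  obtain ⟨s, hs, hs'⟩ := exists_isUPair hx hx
  obtain ⟨t, ht, ht'⟩ := exists_isUPair hx hy
  obtain ⟨p, hp, hp'⟩ := exists_isUPair hs ht
  exact ⟨p, hp, s, t, hs', ht', hp'⟩

end StdV

theorem IsOPair.inj {M : Type*} [memLang.Structure M] {p x y x' y' : M} (h : IsOPair p x y)
    (h' : IsOPair p x' y') : x = x' ∧ y = y' := by
  obtain ⟨s, t, hs, ht, hp⟩ := h
  obtain ⟨s', t', hs', ht', hp'⟩ := h'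
  have hx : x = x' := by
    rcases (hp' s).1 ((hp s).2 (Or.inl rfl)) with rfl | rfl
    · simpa using (hs' x).1 ((hs x).2 (Or.inl rfl))
    · exact (or_self_iff.1 ((hs x').1 ((ht' x').2 (Or.inl rfl)))).symm
  subst hx
  refine ⟨rfl, ?_⟩
  have h₁ : y = x ∨ y = y' := by
    rcases (hp' t).1 ((hp t).2 (Or.inr rfl)) with rfl | rfl
    · exact Or.inl (or_self_iff.1 ((hs' y).1 ((ht y).2 (Or.inr rfl))))
    · exact (ht' y).1 ((ht y).2 (Or.inr rfl))
  have h₂ : y' = x ∨ y' = y := by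
    rcases (hp t').1 ((hp' t').2 (Or.inr rfl)) with rfl | rfl
    · exact Or.inl (or_self_iff.1 ((hs y').1 ((ht' y').2 (Or.inr rfl))))
    · exact (ht y').1 ((ht' y').2 (Or.inr rfl))
  grind

namespace StdV

theorem relHolds_of_graph {n : ℕ} {R : StdV → StdV → Prop} {x y : StdV}
    (h : RelHolds (graph n R) x y) : R x y := by
  obtain ⟨p, hp, hpc⟩ := h
  obtain ⟨⟨x', y', hp', hR⟩, -⟩ := elem_ofSet.1 hpc
  obtain ⟨rfl, rfl⟩ := hp.inj hp'
  exact hR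

/-- The shift by two is the rank that a Kuratowski pair adds; without it `graph` could cut the pair
off. -/
theorem relHolds_graph {n : ℕ} {R : StdV → StdV → Prop} {x y : StdV}
    (hx : x ∈ Set.range (mk n)) (hy : y ∈ Set.range (mk n)) (h : R x y) :
    RelHolds (graph (n + 2) R) x y := by
  obtain ⟨p, hp, hp'⟩ := exists_isOPair hx hy
  exact ⟨p, hp', elem_ofSet.2 ⟨⟨x, y, hp', h⟩, hp⟩⟩

theorem relHolds_natLE {x y : StdV} :
    RelHolds natLE x y ↔ ∃ i j : ℕ, x = atom i ∧ y = atom j ∧ i ≤ j := by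
  refine ⟨relHolds_of_graph, fun h => ?_⟩
  obtain ⟨i, j, rfl, rfl, hij⟩ := id h
  exact relHolds_graph (atom_mem_range 0 i) (atom_mem_range 0 j) h

theorem relHolds_ratioGE {p q : ℕ} {x y : StdV} :
    RelHolds (ratioGE p q) x y ↔ ∃ i j : ℕ, x = atom i ∧ y = atom j ∧ p * j ≤ q * i := by
  refine ⟨relHolds_of_graph, fun h => ?_⟩
  obtain ⟨i, j, rfl, rfl, hij⟩ := id h
  exact relHolds_graph (atom_mem_range 0 i) (atom_mem_range 0 j) h

/-- A function from the finite sets of natural numbers to the natural numbers, as an element of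
`V`. -/
def finsetFun (g : Finset ℕ → ℕ) : StdV :=
  graph 3 fun x y => ∃ F : Finset ℕ, x = natSet F ∧ y = atom (g F)

theorem relHolds_finsetFun {g : Finset ℕ → ℕ} {x y : StdV} :
    RelHolds (finsetFun g) x y ↔ ∃ F : Finset ℕ, x = natSet F ∧ y = atom (g F) := by
  refine ⟨relHolds_of_graph, fun h => ?_⟩
  obtain ⟨F, rfl, rfl⟩ := id h
  exact relHolds_graph (n := 1) ⟨_, rfl⟩ (atom_mem_range 1 _) h

theorem relHolds_finCard {x y : StdV} :
    RelHolds finCard x y ↔ ∃ F : Finset ℕ, x = natSet F ∧ y = atom F.card :=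
  relHolds_finsetFun

end StdV

/-! ### Formulas for membership and pairs -/

section Formulas

open FirstOrder FirstOrder.Language

variable {n : ℕ} {M : Type*} [memLang.Structure M] {v : StdV → M} {xs : Fin n → M}

/-- The terms of the language of membership with parameters in `V` and variables `&0, …, &(n-1)`. -/
abbrev MemTerm (n : ℕ) : Type := StdV ⊕ Fin n

/-- The formulas of the language of membership with parameters in `V` and variables
`&0, …, &(n-1)`. -/
abbrev MemFormula (n : ℕ) : Type := memLang.BoundedFormula StdV n

/-- A term, seen with one more variable. -/
def MemTerm.lift (t : MemTerm n) : MemTerm (n + 1) := Sum.map id Fin.castSucc t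

@[simp]
theorem MemTerm.elim_lift {M : Type*} {v : StdV → M} {xs : Fin n → M} (t : MemTerm n) (a : M) :
    Sum.elim v (Fin.snoc xs a : Fin (n + 1) → M) t.lift = Sum.elim v xs t := by
  cases t <;> simp [MemTerm.lift]

/-- The membership symbol. -/
def memRel : memLang.Relations 2 := MemSymbol.mem

/-- The formula `s = t`. -/
def eqF (s t : MemTerm n) : MemFormula n :=
  Term.bdEqual (Term.var s) (Term.var t)

/-- The formula `s ∈ t`. -/
def memF (s t : MemTerm n) : MemFormula n :=
  memRel.boundedFormula₂ (Term.var s) (Term.var t)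

/-- The formula `r = {s, t}`. -/
def upairF (r s t : MemTerm n) : MemFormula n :=
  ((memF (.inr (Fin.last n)) r.lift).iff
    (eqF (.inr (Fin.last n)) s.lift ⊔ eqF (.inr (Fin.last n)) t.lift)).all

/-- The formula `r = (s, t)`. -/
def opairF (r s t : MemTerm n) : MemFormula n :=
  (upairF (.inr (Fin.last n).castSucc) s.lift.lift s.lift.lift ⊓
    (upairF (.inr (Fin.last (n + 1))) s.lift.lift t.lift.lift ⊓
      upairF r.lift.lift (.inr (Fin.last n).castSucc) (.inr (Fin.last (n + 1))))).ex.ex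

/-- The formula `(s, t) ∈ c`. -/
def relF (c s t : MemTerm n) : MemFormula n :=
  (opairF (.inr (Fin.last n)) s.lift t.lift ⊓ memF (.inr (Fin.last n)) c.lift).ex

@[simp]
theorem realize_eqF {s t : MemTerm n} :
    (eqF s t).Realize v xs ↔ Sum.elim v xs s = Sum.elim v xs t := by
  simp [eqF]

@[simp]
theorem realize_memF {s t : MemTerm n} :
    (memF s t).Realize v xs ↔ Sum.elim v xs s ε Sum.elim v xs t := by
  rw [memF, BoundedFormula.realize_rel₂]
  rfl

@[simp]
theorem realize_upairF {r s t : MemTerm n} : (upairF r s t).Realize v xs ↔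
    IsUPair (Sum.elim v xs r) (Sum.elim v xs s) (Sum.elim v xs t) := by
  simp [upairF, IsUPair]

@[simp]
theorem realize_opairF {r s t : MemTerm n} : (opairF r s t).Realize v xs ↔
    IsOPair (Sum.elim v xs r) (Sum.elim v xs s) (Sum.elim v xs t) := by
  simp [opairF, IsOPair]

@[simp]
theorem realize_relF {c s t : MemTerm n} : (relF c s t).Realize v xs ↔
    RelHolds (Sum.elim v xs c) (Sum.elim v xs s) (Sum.elim v xs t) := by
  simp [relF, RelHolds]

end Formulas

/-! ### Transfer, and the internal arithmetic obtained from it -/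

namespace NonstandardUniverse

open FirstOrder FirstOrder.Language StdV

variable (U : NonstandardUniverse.{u})

/-- The predicates `P` on `V` and `Q` on `*V` are defined by the same formula. -/
def SameFormula {n : ℕ} (P : (Fin n → StdV) → Prop) (Q : (Fin n → U.Carrier) → Prop) : Prop :=
  ∃ φ : MemFormula n, (∀ xs, φ.Realize id xs ↔ P xs) ∧ ∀ xs, φ.Realize U.star xs ↔ Q xs

namespace SameFormula

variable {U} {n : ℕ} {P P' : (Fin n → StdV) → Prop} {Q Q' : (Fin n → U.Carrier) → Prop}

theorem eq (s t : MemTerm n) : U.SameFormula (fun xs => Sum.elim id xs s = Sum.elim id xs t)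
    (fun xs => Sum.elim U.star xs s = Sum.elim U.star xs t) :=
  ⟨eqF s t, fun _ => realize_eqF, fun _ => realize_eqF⟩

theorem mem (s t : MemTerm n) : U.SameFormula (fun xs => Sum.elim id xs s ε Sum.elim id xs t)
    (fun xs => Sum.elim U.star xs s ε Sum.elim U.star xs t) :=
  ⟨memF s t, fun _ => realize_memF, fun _ => realize_memF⟩

theorem rel (c : StdV) (s t : MemTerm n) :
    U.SameFormula (fun xs => RelHolds c (Sum.elim id xs s) (Sum.elim id xs t))
      (fun xs => RelHolds (U.star c) (Sum.elim U.star xs s) (Sum.elim U.star xs t)) :=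
  ⟨relF (.inl c) s t, fun _ => realize_relF, fun _ => realize_relF⟩

theorem imp (h : U.SameFormula P Q) (h' : U.SameFormula P' Q') :
    U.SameFormula (fun xs => P xs → P' xs) (fun xs => Q xs → Q' xs) := by
  obtain ⟨φ, h₁, h₂⟩ := h
  obtain ⟨ψ, h₃, h₄⟩ := h'
  exact ⟨φ.imp ψ, by simp [h₁, h₃], by simp [h₂, h₄]⟩

theorem iff (h : U.SameFormula P Q) (h' : U.SameFormula P' Q') :
    U.SameFormula (fun xs => P xs ↔ P' xs) (fun xs => Q xs ↔ Q' xs) := by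
  obtain ⟨φ, h₁, h₂⟩ := h
  obtain ⟨ψ, h₃, h₄⟩ := h'
  exact ⟨φ.iff ψ, by simp [h₁, h₃], by simp [h₂, h₄]⟩

theorem and (h : U.SameFormula P Q) (h' : U.SameFormula P' Q') :
    U.SameFormula (fun xs => P xs ∧ P' xs) (fun xs => Q xs ∧ Q' xs) := by
  obtain ⟨φ, h₁, h₂⟩ := h
  obtain ⟨ψ, h₃, h₄⟩ := h'
  exact ⟨φ ⊓ ψ, by simp [h₁, h₃], by simp [h₂, h₄]⟩

theorem or (h : U.SameFormula P Q) (h' : U.SameFormula P' Q') :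
    U.SameFormula (fun xs => P xs ∨ P' xs) (fun xs => Q xs ∨ Q' xs) := by
  obtain ⟨φ, h₁, h₂⟩ := h
  obtain ⟨ψ, h₃, h₄⟩ := h'
  exact ⟨φ ⊔ ψ, by simp [h₁, h₃], by simp [h₂, h₄]⟩

theorem not (h : U.SameFormula P Q) : U.SameFormula (fun xs => ¬ P xs) (fun xs => ¬ Q xs) := by
  obtain ⟨φ, h₁, h₂⟩ := h
  exact ⟨∼φ, by simp [h₁], by simp [h₂]⟩

theorem all {P : (Fin (n + 1) → StdV) → Prop} {Q : (Fin (n + 1) → U.Carrier) → Prop}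
    (h : U.SameFormula P Q) :
    U.SameFormula (fun xs => ∀ x, P (Fin.snoc xs x)) (fun xs => ∀ x, Q (Fin.snoc xs x)) := by
  obtain ⟨φ, h₁, h₂⟩ := h
  exact ⟨φ.all, by simp [h₁], by simp [h₂]⟩

theorem ex {P : (Fin (n + 1) → StdV) → Prop} {Q : (Fin (n + 1) → U.Carrier) → Prop}
    (h : U.SameFormula P Q) :
    U.SameFormula (fun xs => ∃ x, P (Fin.snoc xs x)) (fun xs => ∃ x, Q (Fin.snoc xs x)) := by
  obtain ⟨φ, h₁, h₂⟩ := h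
  exact ⟨φ.ex, by simp [h₁], by simp [h₂]⟩

/-- Transfer: what holds for all values of the variables in `V` does so in `*V`. -/
theorem transfer (h : U.SameFormula P Q) (hP : ∀ xs, P xs) (xs : Fin n → U.Carrier) : Q xs := by
  obtain ⟨φ, h₁, h₂⟩ := h
  have h₃ : φ.alls.Realize (M := StdV) id := BoundedFormula.realize_alls.2 fun xs => (h₁ xs).2 (hP xs)
  have h₄ : φ.alls.Realize (U.star ∘ id) := (U.star.map_formula _ _).2 h₃
  exact (h₂ xs).1 (BoundedFormula.realize_alls.1 h₄ xs)

end SameFormula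

variable {U} {a b c h k l H x : U.Carrier}

/-- This makes `loebPre` well defined: the infimum over all codes of an internal set runs over a
single value. -/
theorem internalCard_unique (ha : U.IsInternalCard a h)
    (hb : U.IsInternalCard b k) (hab : ∀ x, x ε a ↔ x ε b) : h = k := by
  -- The pattern of all transfers below: `.inr i` is the `i`-th entry of the final vector, bound
  -- variables take the next free indices, `.inl` is a standard parameter. What remains to prove is
  -- the statement in `V`.
  refine ((SameFormula.rel finCard (.inr 0) (.inr 1)).imp
    ((SameFormula.rel finCard (.inr 2) (.inr 3)).imp
      (((SameFormula.mem (.inr 4) (.inr 0)).iff (SameFormula.mem (.inr 4) (.inr 2))).all.imp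
        (SameFormula.eq (.inr 1) (.inr 3))))).transfer (n := 4) ?_ ![a, h, b, k] ha hb hab
  intro xs h₁ h₂ (h₃ : ∀ x, x ε xs 0 ↔ x ε xs 2)
  obtain ⟨F, hF, hF'⟩ := relHolds_finCard.1 h₁
  obtain ⟨G, hG, hG'⟩ := relHolds_finCard.1 h₂
  have : F = G := by
    ext k
    have := h₃ (atom k)
    rw [show xs 0 = _ from hF, show xs 2 = _ from hG] at this
    simpa [atom_elem_natSet] using this
  change xs 1 = _ at hF'
  change xs 3 = _ at hG'
  change xs 1 = xs 3
  rw [hF', hG', this]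

theorem exists_internal_diff (ha : U.IsInternalCard a h) (hb : U.IsInternalCard b k) :
    ∃ c l, U.IsInternalCard c l ∧ ∀ x, x ε c ↔ x ε a ∧ ¬ x ε b := by
  refine ((SameFormula.rel finCard (.inr 0) (.inr 1)).imp
    ((SameFormula.rel finCard (.inr 2) (.inr 3)).imp
      ((SameFormula.rel finCard (.inr 4) (.inr 5)).and
        ((SameFormula.mem (.inr 6) (.inr 4)).iff ((SameFormula.mem (.inr 6) (.inr 0)).and
          (SameFormula.mem (.inr 6) (.inr 2)).not)).all).ex.ex)).transfer (n := 4) ?_ ![a, h, b, k]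
            ha hb
  intro xs h₁ h₂
  change ∃ c l, RelHolds finCard c l ∧ ∀ x, x ε c ↔ x ε xs 0 ∧ ¬ x ε xs 2
  obtain ⟨F, hF, hF'⟩ := relHolds_finCard.1 h₁
  obtain ⟨G, hG, hG'⟩ := relHolds_finCard.1 h₂
  refine ⟨natSet (F \ G : Finset ℕ), atom (F \ G).card, relHolds_finCard.2 ⟨_, rfl, rfl⟩,
    fun x => ?_⟩
  rw [show xs 0 = _ from hF, show xs 2 = _ from hG]
  simp only [elem_natSet, Finset.coe_sdiff, Set.mem_sdiff, Finset.mem_coe]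
  grind [atom_injective.eq_iff]

theorem IsInternalCard.mem_starNat (ha : U.IsInternalCard a h) : h ∈ U.starNat := by
  refine ((SameFormula.rel finCard (.inr 0) (.inr 1)).imp
    (SameFormula.mem (.inr 1) (.inl (level 0)))).transfer (n := 2) ?_ ![a, h] ha
  intro xs h₁
  obtain ⟨F, hF, hF'⟩ := relHolds_finCard.1 h₁
  exact elem_level_zero.2 ⟨_, hF'⟩

theorem IsInternalCard.mem_starV (ha : U.IsInternalCard a h) : a ∈ U.starV := by
  refine ⟨1, ((SameFormula.rel finCard (.inr 0) (.inr 1)).imp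
    (SameFormula.mem (.inr 0) (.inl (level 1)))).transfer (n := 2) ?_ ![a, h] ha⟩
  intro xs h₁
  obtain ⟨F, hF, hF'⟩ := relHolds_finCard.1 h₁
  refine elem_ofSet.2 ⟨trivial, ?_⟩
  change xs 0 = _ at hF
  change xs 0 ∈ _
  rw [hF]
  exact ⟨_, rfl⟩

theorem exists_internal_inter (A : Set ℕ) (hH : H ∈ U.starNat) :
    ∃ a h, U.IsInternalCard a h ∧ ∀ x, x ε a ↔ (x ∈ U.starNat ∧
      RelHolds (U.star natLE) (U.star (atom 1)) x ∧ RelHolds (U.star natLE) x H) ∧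
        x ε U.star (natSet A) := by
  refine ((SameFormula.mem (.inr 0) (.inl (level 0))).imp
    ((SameFormula.rel finCard (.inr 1) (.inr 2)).and
      ((SameFormula.mem (.inr 3) (.inr 1)).iff (((SameFormula.mem (.inr 3) (.inl (level 0))).and
        ((SameFormula.rel natLE (.inl (atom 1)) (.inr 3)).and
          (SameFormula.rel natLE (.inr 3) (.inr 0)))).and
        (SameFormula.mem (.inr 3) (.inl (natSet A))))).all).ex.ex).transfer (n := 1) ?_ ![H] hH
  intro xs h₁
  obtain ⟨n, hn⟩ := elem_level_zero.1 h₁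
  change xs 0 = _ at hn
  change ∃ a h, RelHolds finCard a h ∧ ∀ x, x ε a ↔ (x ε level 0 ∧ RelHolds natLE (atom 1) x ∧
    RelHolds natLE x (xs 0)) ∧ x ε natSet A
  classical
  refine ⟨natSet ((Finset.Icc 1 n).filter (· ∈ A) : Finset ℕ), _,
    relHolds_finCard.2 ⟨_, rfl, rfl⟩, fun x => ?_⟩
  simp only [hn, elem_natSet, elem_level_zero, relHolds_natLE, Finset.coe_filter, Finset.mem_Icc,
    Set.mem_ofPred_eq]
  grind [atom_injective.eq_iff]

/-- A property of the number of elements of `A ∩ {1, …, n}` that holds for all large `n ∈ ℕ` holds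
for infinite `n`. -/
theorem transfer_count {P : (Fin 3 → StdV) → Prop} {Q : (Fin 3 → U.Carrier) → Prop}
    (hPQ : U.SameFormula P Q) (A : Set ℕ) [DecidablePred (· ∈ A)] (C : ℕ)
    (hP : ∀ xs, ∀ n ≥ C, xs 1 = atom ((Finset.Icc 1 n).filter (· ∈ A)).card → xs 2 = atom n → P xs)
    (hH : RelHolds (U.star natLE) (U.star (atom C)) H) (ha : U.IsInternalCard a h)
    (hax : ∀ x, x ε a ↔ (x ∈ U.starNat ∧
      RelHolds (U.star natLE) (U.star (atom 1)) x ∧ RelHolds (U.star natLE) x H) ∧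
        x ε U.star (natSet A)) : Q ![a, h, H] := by
  refine ((SameFormula.rel natLE (.inl (atom C)) (.inr 2)).imp
    ((SameFormula.rel finCard (.inr 0) (.inr 1)).imp
      (((SameFormula.mem (.inr 3) (.inr 0)).iff (((SameFormula.mem (.inr 3) (.inl (level 0))).and
        ((SameFormula.rel natLE (.inl (atom 1)) (.inr 3)).and
          (SameFormula.rel natLE (.inr 3) (.inr 2)))).and
        (SameFormula.mem (.inr 3) (.inl (natSet A))))).all.imp hPQ))).transfer (n := 3) ?_
          ![a, h, H] hH ha hax
  intro xs h₁ h₂ (h₃ : ∀ x, x ε xs 0 ↔ (x ε level 0 ∧ RelHolds natLE (atom 1) x ∧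
    RelHolds natLE x (xs 2)) ∧ x ε natSet A)
  obtain ⟨i, n, hi, hn, hin⟩ := relHolds_natLE.1 h₁
  obtain ⟨F, hF, hF'⟩ := relHolds_finCard.1 h₂
  change xs 0 = _ at hF
  change xs 1 = _ at hF'
  change xs 2 = _ at hn
  obtain rfl := atom_injective hi
  refine hP xs n hin ?_ hn
  rw [hF']
  congr 2
  ext k
  have := h₃ (atom k)
  simp only [hn, hF, atom_elem_natSet, elem_level_zero, relHolds_natLE] at this
  simp only [Finset.mem_filter, Finset.mem_Icc]
  grind [atom_injective.eq_iff]

/-- External induction on the standard `n`: by transfer, an element that is at least `n` is `n` or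
at least `n + 1`, and `H` is not standard. -/
theorem IsHyperfinite.le_star_atom (hH : U.IsHyperfinite H) (n : ℕ) :
    RelHolds (U.star natLE) (U.star (atom n)) H := by
  induction n with
  | zero =>
    refine ((SameFormula.mem (.inr 0) (.inl (level 0))).imp
      (SameFormula.rel natLE (.inl (atom 0)) (.inr 0))).transfer (n := 1) ?_ ![H] hH.1
    intro xs h₁
    obtain ⟨n, hn⟩ := elem_level_zero.1 h₁
    exact relHolds_natLE.2 ⟨0, n, rfl, hn, n.zero_le⟩
  | succ n ih =>
    refine (((SameFormula.rel natLE (.inl (atom n)) (.inr 0)).imp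
      ((SameFormula.eq (.inr 0) (.inl (atom n))).or
        (SameFormula.rel natLE (.inl (atom (n + 1))) (.inr 0)))).transfer
          (n := 1) ?_ ![H] ih).resolve_left (hH.2 n)
    intro xs h₁
    obtain ⟨i, j, hi, hj, hij⟩ := relHolds_natLE.1 h₁
    obtain rfl := atom_injective hi
    rcases hij.eq_or_lt with rfl | hij
    · exact Or.inl hj
    · exact Or.inr (relHolds_natLE.2 ⟨_, j, rfl, hj, hij⟩)

theorem elem_star_natSet_compl (A : Set ℕ) (hx : x ∈ U.starNat) :
    x ε U.star (natSet Aᶜ) ↔ ¬ x ε U.star (natSet A) := by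
  refine ((SameFormula.mem (.inr 0) (.inl (level 0))).imp
    ((SameFormula.mem (.inr 0) (.inl (natSet Aᶜ))).iff
      (SameFormula.mem (.inr 0) (.inl (natSet A))).not)).transfer (n := 1) ?_ ![x] hx
  intro xs h₁
  obtain ⟨n, hn⟩ := elem_level_zero.1 h₁
  change xs 0 = _ at hn
  change xs 0 ε _ ↔ ¬ xs 0 ε natSet A
  rw [hn]
  exact atom_elem_natSet.trans atom_elem_natSet.not.symm

theorem elem_star_natSet_inter (A B : Set ℕ) :
    x ε U.star (natSet (A ∩ B)) ↔ x ε U.star (natSet A) ∧ x ε U.star (natSet B) := by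
  refine ((SameFormula.mem (.inr 0) (.inl (natSet (A ∩ B)))).iff
    ((SameFormula.mem (.inr 0) (.inl (natSet A))).and
      (SameFormula.mem (.inr 0) (.inl (natSet B))))).transfer (n := 1) ?_ ![x]
  intro xs
  change xs 0 ε natSet (A ∩ B) ↔ xs 0 ε natSet A ∧ xs 0 ε natSet B
  simp only [elem_natSet, Set.mem_inter_iff]
  grind [atom_injective.eq_iff]

theorem elem_star_natSet_univ (hx : x ∈ U.starNat) : x ε U.star (natSet Set.univ) := by
  refine ((SameFormula.mem (.inr 0) (.inl (level 0))).imp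
    (SameFormula.mem (.inr 0) (.inl (natSet Set.univ)))).transfer (n := 1) ?_ ![x] hx
  intro xs h₁
  obtain ⟨n, hn⟩ := elem_level_zero.1 h₁
  exact elem_natSet.2 ⟨n, trivial, hn⟩

theorem ratioGE_mono {p q p' q' : ℕ} (hq' : 0 < q') (hpq : p * q' ≤ p' * q)
    (hh : RelHolds (U.star (ratioGE p' q')) h H) : RelHolds (U.star (ratioGE p q)) h H := by
  refine ((SameFormula.rel (ratioGE p' q') (.inr 0) (.inr 1)).imp
    (SameFormula.rel (ratioGE p q) (.inr 0) (.inr 1))).transfer (n := 2) ?_ ![h, H] hh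
  intro xs h₁
  obtain ⟨i, j, hi, hj, hij⟩ := relHolds_ratioGE.1 h₁
  refine relHolds_ratioGE.2 ⟨i, j, hi, hj, le_of_mul_le_mul_left ?_ hq'⟩
  calc q' * (p * j) = p * q' * j := by ring
    _ ≤ p' * q * j := Nat.mul_le_mul_right j hpq
    _ = q * (p' * j) := by ring
    _ ≤ q * (q' * i) := Nat.mul_le_mul_left q hij
    _ = q' * (q * i) := by ring

theorem card_disjoint_union {F G K : Finset ℕ} {x y z : StdV} (hx : x = natSet F)
    (hy : y = natSet G) (hz : z = natSet K) (h : ∀ w, w ε z ↔ w ε x ∨ w ε y)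
    (hd : ∀ w, ¬ (w ε x ∧ w ε y)) : K.card = F.card + G.card := by
  subst hx hy hz
  rw [← Finset.card_union_of_disjoint]
  · congr 1
    ext k
    simpa [atom_elem_natSet] using h (atom k)
  · rw [Finset.disjoint_left]
    intro k hF hG
    exact hd (atom k) ⟨atom_elem_natSet.2 hF, atom_elem_natSet.2 hG⟩

theorem ratioGE_add {p q p' q' : ℕ} (ha : U.IsInternalCard a h) (hb : U.IsInternalCard b k)
    (hc : U.IsInternalCard c l) (h_union : ∀ x, x ε c ↔ x ε a ∨ x ε b)
    (h_disj : ∀ x, ¬ (x ε a ∧ x ε b)) (h₁ : RelHolds (U.star (ratioGE p q)) h H)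
    (h₂ : RelHolds (U.star (ratioGE p' q')) k H) :
    RelHolds (U.star (ratioGE (p * q' + p' * q) (q * q'))) l H := by
  refine ((SameFormula.rel finCard (.inr 0) (.inr 1)).imp
    ((SameFormula.rel finCard (.inr 2) (.inr 3)).imp
    ((SameFormula.rel finCard (.inr 4) (.inr 5)).imp
    (((SameFormula.mem (.inr 7) (.inr 4)).iff
      ((SameFormula.mem (.inr 7) (.inr 0)).or (SameFormula.mem (.inr 7) (.inr 2)))).all.imp
    (((SameFormula.mem (.inr 7) (.inr 0)).and (SameFormula.mem (.inr 7) (.inr 2))).not.all.imp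
    ((SameFormula.rel (ratioGE p q) (.inr 1) (.inr 6)).imp
    ((SameFormula.rel (ratioGE p' q') (.inr 3) (.inr 6)).imp
    (SameFormula.rel (ratioGE (p * q' + p' * q) (q * q')) (.inr 5) (.inr 6))))))))).transfer (n := 7)
      ?_ ![a, h, b, k, c, l, H] ha hb hc h_union h_disj h₁ h₂
  intro xs hF hG hK hu hd h₁ h₂
  obtain ⟨F, hF, hF'⟩ := relHolds_finCard.1 hF
  obtain ⟨G, hG, hG'⟩ := relHolds_finCard.1 hG
  obtain ⟨K, hK, hK'⟩ := relHolds_finCard.1 hK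
  obtain ⟨i, j, hi, hj, hij⟩ := relHolds_ratioGE.1 h₁
  obtain ⟨i', j', hi', hj', hij'⟩ := relHolds_ratioGE.1 h₂
  refine relHolds_ratioGE.2 ⟨_, j, hK', hj, ?_⟩
  obtain rfl := atom_injective (hF'.symm.trans hi)
  obtain rfl := atom_injective (hG'.symm.trans hi')
  obtain rfl := atom_injective (hj.symm.trans hj')
  rw [card_disjoint_union hF hG hK hu hd]
  nlinarith [Nat.mul_le_mul_left q' hij, Nat.mul_le_mul_left q hij']

/-- The upper-bound companion of `ratioGE_add`. As a negated relation could also hold because an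
argument is not a number, `hH` is needed to read it as a strict inequality. -/
theorem not_ratioGE_add {p q p' q' : ℕ} (hH : H ∈ U.starNat) (hq : 0 < q) (hq' : 0 < q')
    (ha : U.IsInternalCard a h) (hb : U.IsInternalCard b k)
    (hc : U.IsInternalCard c l) (h_union : ∀ x, x ε c ↔ x ε a ∨ x ε b)
    (h_disj : ∀ x, ¬ (x ε a ∧ x ε b)) (h₁ : ¬ RelHolds (U.star (ratioGE p q)) h H)
    (h₂ : ¬ RelHolds (U.star (ratioGE p' q')) k H) :
    ¬ RelHolds (U.star (ratioGE (p * q' + p' * q) (q * q'))) l H := by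
  refine ((SameFormula.mem (.inr 6) (.inl (level 0))).imp
    ((SameFormula.rel finCard (.inr 0) (.inr 1)).imp
    ((SameFormula.rel finCard (.inr 2) (.inr 3)).imp
    ((SameFormula.rel finCard (.inr 4) (.inr 5)).imp
    (((SameFormula.mem (.inr 7) (.inr 4)).iff
      ((SameFormula.mem (.inr 7) (.inr 0)).or (SameFormula.mem (.inr 7) (.inr 2)))).all.imp
    (((SameFormula.mem (.inr 7) (.inr 0)).and (SameFormula.mem (.inr 7) (.inr 2))).not.all.imp
    ((SameFormula.rel (ratioGE p q) (.inr 1) (.inr 6)).not.imp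
    ((SameFormula.rel (ratioGE p' q') (.inr 3) (.inr 6)).not.imp
    (SameFormula.rel (ratioGE (p * q' + p' * q) (q * q')) (.inr 5)
      (.inr 6)).not)))))))).transfer (n := 7)
        ?_ ![a, h, b, k, c, l, H] hH ha hb hc h_union h_disj h₁ h₂
  intro xs hN hF hG hK hu hd h₁ h₂ h₃
  obtain ⟨n, hn⟩ := elem_level_zero.1 hN
  obtain ⟨F, hF, hF'⟩ := relHolds_finCard.1 hF
  obtain ⟨G, hG, hG'⟩ := relHolds_finCard.1 hG
  obtain ⟨K, hK, hK'⟩ := relHolds_finCard.1 hK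
  obtain ⟨i, j, hi, hj, hij⟩ := relHolds_ratioGE.1 h₃
  obtain rfl := atom_injective (hK'.symm.trans hi)
  obtain rfl := atom_injective (hn.symm.trans hj)
  rw [card_disjoint_union hF hG hK hu hd] at hij
  have h₁' : q * F.card < p * n := by
    by_contra! h
    exact h₁ (relHolds_ratioGE.2 ⟨_, _, hF', hn, h⟩)
  have h₂' : q' * G.card < p' * n := by
    by_contra! h
    exact h₂ (relHolds_ratioGE.2 ⟨_, _, hG', hn, h⟩)
  nlinarith [Nat.mul_lt_mul_of_pos_left h₁' hq', Nat.mul_lt_mul_of_pos_left h₂' hq]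

/-- Transfer of the injectivity of an encoding of finite sets of naturals by naturals; it bounds the
number of internal subsets of `Ω` by the size of `*ℕ`. -/
theorem exists_internal_code : ∃ g : U.Carrier → U.Carrier,
    (∀ a h, U.IsInternalCard a h → g a ∈ U.starNat) ∧
      ∀ a b h k, U.IsInternalCard a h → U.IsInternalCard b k → g a = g b → a = b := by
  have h₁ : ∀ a h, U.IsInternalCard a h → ∃ m, m ε U.star (level 0) ∧
      RelHolds (U.star (finsetFun Encodable.encode)) a m := by
    intro a h ha
    refine ((SameFormula.rel finCard (.inr 0) (.inr 1)).imp
      ((SameFormula.mem (.inr 2) (.inl (level 0))).and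
        (SameFormula.rel (finsetFun Encodable.encode) (.inr 0) (.inr 2))).ex).transfer (n := 2) ?_
          ![a, h] ha
    intro xs h₁
    obtain ⟨F, hF, hF'⟩ := relHolds_finCard.1 h₁
    exact ⟨atom (Encodable.encode F), elem_level_zero.2 ⟨_, rfl⟩,
      relHolds_finsetFun.2 ⟨F, hF, rfl⟩⟩
  have h₂ : ∀ a b m, RelHolds (U.star (finsetFun Encodable.encode)) a m →
      RelHolds (U.star (finsetFun Encodable.encode)) b m → a = b := by
    intro a b m ha hb
    refine ((SameFormula.rel (finsetFun Encodable.encode) (.inr 0) (.inr 2)).imp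
      ((SameFormula.rel (finsetFun Encodable.encode) (.inr 1) (.inr 2)).imp
        (SameFormula.eq (.inr 0) (.inr 1)))).transfer (n := 3) ?_ ![a, b, m] ha hb
    intro xs h₁ h₂
    obtain ⟨F, hF, hF'⟩ := relHolds_finsetFun.1 h₁
    obtain ⟨G, hG, hG'⟩ := relHolds_finsetFun.1 h₂
    obtain rfl := Encodable.encode_injective (atom_injective (hF'.symm.trans hG'))
    exact hF.trans hG.symm
  classical
  choose g hg hg' using h₁
  refine ⟨fun a => if ha : ∃ h, U.IsInternalCard a h then g a _ ha.choose_spec else a,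
    fun a h ha => ?_, fun a b h k ha hb hab => ?_⟩
  · have ha' : ∃ h, U.IsInternalCard a h := ⟨h, ha⟩
    beta_reduce
    rw [dif_pos ha']
    exact hg _ _ _
  · have ha' : ∃ h, U.IsInternalCard a h := ⟨h, ha⟩
    have hb' : ∃ h, U.IsInternalCard b h := ⟨k, hb⟩
    simp only [dif_pos ha', dif_pos hb'] at hab
    exact h₂ a b _ (hg' _ _ ha'.choose_spec) (hab ▸ hg' _ _ hb'.choose_spec)

end NonstandardUniverse

/-! ### Rational bounds and additivity of the standard part -/

theorem ENNReal.exists_nat_div_btwn {a b : ENNReal} (h : a < b) :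
    ∃ p q : ℕ, 0 < q ∧ a < (p : ENNReal) / q ∧ (p : ENNReal) / q < b := by
  obtain ⟨r, hr, h₁, h₂⟩ := ENNReal.lt_iff_exists_rat_btwn.1 h
  have : ((r : ℝ).toNNReal : ENNReal) = (r.num.toNat : ENNReal) / r.den := by
    rw [← ENNReal.coe_natCast, ← ENNReal.coe_natCast, ← ENNReal.coe_div (by simp)]
    congr 1
    rw [← NNReal.coe_inj, Real.coe_toNNReal _ (by exact_mod_cast hr)]
    have h₃ : ((r.num.toNat : ℤ) : ℝ) = r.num := by
      rw [Int.toNat_of_nonneg (Rat.num_nonneg.2 hr)]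
    push_cast at h₃ ⊢
    rw [h₃]
    exact_mod_cast (Rat.num_div_den r).symm
  exact ⟨r.num.toNat, r.den, r.den_pos, this ▸ h₁, this ▸ h₂⟩

theorem ENNReal.nat_div_add_nat_div {p q p' q' : ℕ} (hq : 0 < q) (hq' : 0 < q') :
    ((p * q' + p' * q : ℕ) : ENNReal) / (q * q' : ℕ) = (p : ENNReal) / q + (p' : ENNReal) / q' := by
  have h : (q : ENNReal) ≠ 0 := by simpa using hq.ne'
  have h' : (q' : ENNReal) ≠ 0 := by simpa using hq'.ne'
  push_cast
  rw [← ENNReal.div_add_div_same, ENNReal.mul_div_mul_right _ _ h' (by simp), mul_comm (q : ENNReal),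
    ENNReal.mul_div_mul_right _ _ h (by simp)]

theorem ENNReal.nat_div_le_nat_div {p q p' q' : ℕ} (hq : 0 < q) (hq' : 0 < q')
    (h : p * q' ≤ p' * q) : (p : ENNReal) / q ≤ (p' : ENNReal) / q' := by
  rw [ENNReal.div_le_iff (by simpa using hq.ne') (by simp), ← ENNReal.mul_div_right_comm,
    ENNReal.le_div_iff_mul_le (by simp [hq'.ne']) (by simp)]
  exact_mod_cast h

namespace NonstandardUniverse

open StdV

variable {U : NonstandardUniverse.{u}} {a b c h k l H : U.Carrier}

theorem le_stRatio {p q : ℕ} (hq : 0 < q) (h₁ : RelHolds (U.star (ratioGE p q)) h H) :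
    (p : ENNReal) / q ≤ U.stRatio h H :=
  le_iSup_of_le p (le_iSup_of_le q (le_iSup_of_le ⟨hq, h₁⟩ le_rfl))

theorem stRatio_le {p q : ℕ} (hq : 0 < q) (h₁ : ¬ RelHolds (U.star (ratioGE p q)) h H) :
    U.stRatio h H ≤ (p : ENNReal) / q := by
  refine iSup_le fun p' => iSup_le fun q' => iSup_le fun ⟨hq', h₂⟩ => ?_
  refine ENNReal.nat_div_le_nat_div hq' hq ?_
  by_contra! h₃
  exact h₁ (ratioGE_mono hq' h₃.le h₂)

theorem stRatio_add (hH : H ∈ U.starNat) (ha : U.IsInternalCard a h) (hb : U.IsInternalCard b k)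
    (hc : U.IsInternalCard c l) (h_union : ∀ x, x ε c ↔ x ε a ∨ x ε b)
    (h_disj : ∀ x, ¬ (x ε a ∧ x ε b)) :
    U.stRatio l H = U.stRatio h H + U.stRatio k H := by
  apply le_antisymm
  · by_contra! hlt
    obtain ⟨r, hr, hlt⟩ := ENNReal.lt_iff_exists_add_pos_lt.1 hlt
    have hfin := (ENNReal.add_lt_top.1 (ENNReal.add_lt_top.1 (hlt.trans_le le_top)).1)
    have hr2 : ((r / 2 : NNReal) : ENNReal) ≠ 0 := by simpa using hr.ne'
    -- Rationals strictly above each summand, by less than `r / 2`; the corresponding `ratioGE`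
    -- relations fail, so the sum of the two rationals bounds the total ratio.
    obtain ⟨p, q, hq, h₁, h₂⟩ := ENNReal.exists_nat_div_btwn
      (ENNReal.lt_add_right hfin.1.ne hr2)
    obtain ⟨p', q', hq', h₁', h₂'⟩ := ENNReal.exists_nat_div_btwn
      (ENNReal.lt_add_right hfin.2.ne hr2)
    have h₃ := stRatio_le (Nat.mul_pos hq hq') (not_ratioGE_add hH hq hq' ha hb hc h_union h_disj
      (fun h => h₁.not_ge (le_stRatio hq h)) (fun h => h₁'.not_ge (le_stRatio hq' h)))
    rw [ENNReal.nat_div_add_nat_div hq hq'] at h₃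
    refine (h₃.trans ((add_le_add h₂.le h₂'.le).trans (le_of_eq ?_))).not_gt hlt
    rw [add_add_add_comm, ← ENNReal.coe_add, add_halves]
  · have hzero : ∀ {a h}, U.IsInternalCard a h → RelHolds (U.star (ratioGE 0 1)) h H := by
      intro a h ha
      refine ((SameFormula.mem (.inr 0) (.inl (level 0))).imp
        ((SameFormula.mem (.inr 1) (.inl (level 0))).imp
          (SameFormula.rel (ratioGE 0 1) (.inr 0) (.inr 1)))).transfer (n := 2) ?_ ![h, H]
            ha.mem_starNat hH
      intro xs h₁ h₂
      obtain ⟨i, hi⟩ := elem_level_zero.1 h₁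
      obtain ⟨j, hj⟩ := elem_level_zero.1 h₂
      exact relHolds_ratioGE.2 ⟨i, j, hi, hj, by simp⟩
    have hsup : ∀ h, U.stRatio h H = ⨆ (x : ℕ × ℕ)
        (_ : 0 < x.2 ∧ RelHolds (U.star (ratioGE x.1 x.2)) h H), (x.1 : ENNReal) / x.2 :=
      fun h => iSup_prod' (fun p q : ℕ => ⨆ (_ : 0 < q ∧ RelHolds (U.star (ratioGE p q)) h H),
        (p : ENNReal) / q)
    rw [hsup h, hsup k]
    -- The pair `(0, 1)` shows that neither supremum is over an empty index set.
    refine ENNReal.biSup_add_biSup_le' ⟨(0, 1), one_pos, hzero ha⟩ ⟨(0, 1), one_pos, hzero hb⟩ ?_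
    rintro ⟨p, q⟩ ⟨hq, h₁⟩ ⟨p', q'⟩ ⟨hq', h₂⟩
    rw [← ENNReal.nat_div_add_nat_div hq hq']
    exact le_stRatio (Nat.mul_pos hq hq') (ratioGE_add ha hb hc h_union h_disj h₁ h₂)

/-! ### Internal sets and the Loeb measure -/

/-- A point of `Ω`, as a hypernatural number. -/
def Omega.val (x : U.Omega H) : U.Carrier := Subtype.val x

theorem Omega.val_mem (x : U.Omega H) : x.val ∈ U.starNat := x.2.1

theorem Omega.val_injective : Function.Injective (Omega.val (H := H)) := Subtype.val_injective

/-- The internal subsets of `Ω`. -/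
def IsInternal (S : Set (U.Omega H)) : Prop :=
  ∃ a h, U.IsInternalCard a h ∧ {x | x ε a} = Omega.val '' S

variable {S T : Set (U.Omega H)}

theorem IsInternal.diff (hS : IsInternal S) (hT : IsInternal T) : IsInternal (S \ T) := by
  obtain ⟨a, h, ha, haS⟩ := hS
  obtain ⟨b, k, hb, hbT⟩ := hT
  obtain ⟨c, l, hc, hcx⟩ := exists_internal_diff ha hb
  refine ⟨c, l, hc, ?_⟩
  rw [Set.image_sdiff Omega.val_injective, ← haS, ← hbT]
  ext x
  exact hcx x

theorem IsInternal.inter (hS : IsInternal S) (hT : IsInternal T) : IsInternal (S ∩ T) := by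
  rw [← Set.sdiff_sdiff_right_self]
  exact hS.diff (hS.diff hT)

theorem exists_code_elem_star (hH : H ∈ U.starNat) (A : Set ℕ) :
    ∃ a h, U.IsInternalCard a h ∧
      {x | x ε a} = Omega.val '' {x : U.Omega H | x.val ε U.star (natSet A)} ∧
      ∀ x, x ε a ↔ (x ∈ U.starNat ∧ RelHolds (U.star natLE) (U.star (atom 1)) x ∧
        RelHolds (U.star natLE) x H) ∧ x ε U.star (natSet A) := by
  obtain ⟨a, h, ha, hax⟩ := exists_internal_inter A hH
  refine ⟨a, h, ha, ?_, hax⟩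
  ext x
  refine (hax x).trans ?_
  exact ⟨fun ⟨h₁, h₂⟩ => ⟨⟨x, h₁⟩, h₂, rfl⟩, fun ⟨y, hy, hyx⟩ => hyx ▸ ⟨y.2, hy⟩⟩

theorem isInternal_elem_star (hH : H ∈ U.starNat) (A : Set ℕ) :
    IsInternal {x : U.Omega H | x.val ε U.star (natSet A)} := by
  obtain ⟨a, h, ha, hS, -⟩ := exists_code_elem_star hH A
  exact ⟨a, h, ha, hS⟩

theorem elem_star_univ_eq : {x : U.Omega H | x.val ε U.star (natSet Set.univ)} = Set.univ :=
  Set.eq_univ_of_forall fun x => elem_star_natSet_univ x.val_mem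

theorem isInternal_univ (hH : H ∈ U.starNat) : IsInternal (Set.univ : Set (U.Omega H)) :=
  elem_star_univ_eq (H := H) ▸ isInternal_elem_star hH Set.univ

theorem IsInternal.compl (hH : H ∈ U.starNat) (hS : IsInternal S) : IsInternal Sᶜ :=
  Set.compl_eq_univ_sdiff S ▸ (isInternal_univ hH).diff hS

theorem loebPre_eq (ha : U.IsInternalCard a h) (hS : {x | x ε a} = Omega.val '' S) :
    loebPre H S = U.stRatio h H := by
  apply le_antisymm
  · exact iInf_le_of_le a (iInf_le_of_le h (iInf_le_of_le ⟨hS, ha⟩ le_rfl))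
  · refine le_iInf fun b => le_iInf fun k => le_iInf fun ⟨hb, hk⟩ => ?_
    rw [internalCard_unique ha hk fun x => Set.ext_iff.1 (hS.trans hb.symm) x]

theorem isInternal_of_loebPre_ne_top (hS : loebPre H S ≠ ⊤) : IsInternal S := by
  contrapose! hS
  simp only [loebPre, iInf_eq_top]
  exact fun a h ⟨h₁, h₂⟩ => (hS ⟨a, h, h₂, h₁⟩).elim

theorem loebPre_inter_add_diff (hH : H ∈ U.starNat) (hS : IsInternal S) (hT : IsInternal T) :
    loebPre H (S ∩ T) + loebPre H (S \ T) = loebPre H S := by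
  obtain ⟨a, h, ha, haS⟩ := id hS
  obtain ⟨b, k, hb, hbS⟩ := hS.inter hT
  obtain ⟨c, l, hc, hcS⟩ := hS.diff hT
  rw [loebPre_eq ha haS, loebPre_eq hb hbS, loebPre_eq hc hcS]
  refine (stRatio_add hH hb hc ha (fun x => ?_) fun x => ?_).symm
  · change x ∈ {x | x ε a} ↔ x ∈ {x | x ε b} ∨ x ∈ {x | x ε c}
    rw [haS, hbS, hcS, ← Set.mem_union, ← Set.image_union, Set.inter_union_sdiff]
  · change ¬ (x ∈ {x | x ε b} ∧ x ∈ {x | x ε c})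
    rw [hbS, hcS]
    rintro ⟨⟨y, hy, rfl⟩, ⟨z, hz, hzy⟩⟩
    exact hz.2 (Omega.val_injective hzy ▸ hy.2)

open Filter Topology in
/-- The measure of the trace on `Ω` of a standard set of natural numbers is its asymptotic
density. -/
theorem loebPre_of_density (hH : U.IsHyperfinite H) {A : Set ℕ} [DecidablePred (· ∈ A)] {d : ℝ}
    (hd : Tendsto (fun n : ℕ => (((Finset.Icc 1 n).filter (· ∈ A)).card : ℝ) / n) atTop (𝓝 d)) :
    loebPre H {x : U.Omega H | x.val ε U.star (natSet A)} = ENNReal.ofReal d := by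
  obtain ⟨a, h, ha, haS, hax⟩ := exists_code_elem_star hH.1 A
  have hcast : ∀ {p q : ℕ}, 0 < q → (p : ENNReal) / q = ENNReal.ofReal ((p : ℝ) / q) := by
    intro p q hq
    rw [ENNReal.ofReal_div_of_pos (by exact_mod_cast hq), ENNReal.ofReal_natCast,
      ENNReal.ofReal_natCast]
  have hd0 : 0 ≤ d := ge_of_tendsto' hd fun n => by positivity
  rw [loebPre_eq ha haS]
  apply le_antisymm
  · by_contra! hlt
    -- A rational above `d` bounds the counting ratio from some `C` on, and this bound transfers to
    -- the infinite `H`. The other direction uses a rational below `d`.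
    obtain ⟨p, q, hq, h₁, h₂⟩ := ENNReal.exists_nat_div_btwn hlt
    rw [hcast hq, ENNReal.ofReal_lt_ofReal_iff_of_nonneg hd0] at h₁
    obtain ⟨C, hC⟩ := eventually_atTop.1 ((hd.eventually_lt_const h₁).and (eventually_gt_atTop 0))
    refine h₂.not_ge (stRatio_le hq (transfer_count
      (SameFormula.rel (ratioGE p q) (.inr 1) (.inr 2)).not A C ?_ (hH.le_star_atom C) ha hax))
    intro xs n hn h₁ h₂ h₃
    obtain ⟨i, j, hi, hj, hij⟩ := relHolds_ratioGE.1 h₃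
    obtain rfl := atom_injective (h₁.symm.trans hi)
    obtain rfl := atom_injective (h₂.symm.trans hj)
    obtain ⟨h₄, h₅⟩ := hC n hn
    rw [div_lt_div_iff₀ (by exact_mod_cast h₅) (by exact_mod_cast hq)] at h₄
    norm_cast at h₄
    rw [mul_comm q] at hij
    exact hij.not_gt h₄
  · refine le_of_forall_lt fun r hr => ?_
    obtain ⟨p, q, hq, h₁, h₂⟩ := ENNReal.exists_nat_div_btwn hr
    refine h₁.trans_le (le_stRatio hq ?_)
    rw [hcast hq, ENNReal.ofReal_lt_ofReal_iff_of_nonneg (by positivity)] at h₂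
    obtain ⟨C, hC⟩ := eventually_atTop.1 ((hd.eventually_const_lt h₂).and (eventually_gt_atTop 0))
    refine transfer_count
      (SameFormula.rel (ratioGE p q) (.inr 1) (.inr 2)) A C ?_ (hH.le_star_atom C) ha hax
    intro xs n hn h₁ h₂
    refine relHolds_ratioGE.2 ⟨_, _, h₁, h₂, ?_⟩
    obtain ⟨h₄, h₅⟩ := hC n hn
    rw [div_lt_div_iff₀ (by exact_mod_cast hq) (by exact_mod_cast h₅)] at h₄
    norm_cast at h₄
    rw [mul_comm q]
    exact h₄.le

open Filter Topology in
theorem loebPre_univ (hH : U.IsHyperfinite H) : loebPre H Set.univ = 1 := by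
  rw [← elem_star_univ_eq, ← ENNReal.ofReal_one]
  refine loebPre_of_density hH ?_
  refine tendsto_const_nhds.congr' ?_
  filter_upwards [eventually_gt_atTop 0] with n hn
  have : (n : ℝ) ≠ 0 := by positivity
  simp [this]

theorem loebPre_mono (hH : H ∈ U.starNat) (hS : IsInternal S) (hT : IsInternal T) (h : S ⊆ T) :
    loebPre H S ≤ loebPre H T := by
  rw [← loebPre_inter_add_diff hH hT hS, Set.inter_eq_right.2 h]
  exact le_self_add

theorem isInternal_empty (hH : H ∈ U.starNat) : IsInternal (∅ : Set (U.Omega H)) := by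
  simpa using (isInternal_univ hH).compl hH

theorem loebPre_empty (hH : U.IsHyperfinite H) : loebPre H ∅ = 0 := by
  have := loebPre_inter_add_diff hH.1 (isInternal_univ hH.1) (isInternal_empty hH.1)
  rw [Set.inter_empty, Set.sdiff_empty, loebPre_univ hH] at this
  exact (ENNReal.add_right_inj ENNReal.one_ne_top).1 ((add_comm _ _).trans (this.trans (add_zero 1).symm))

theorem loebPre_le_sum (hH : U.IsHyperfinite H) (T : ℕ → Set (U.Omega H))
    (hT : ∀ i, IsInternal (T i)) (n : ℕ) :
    ∀ S : Set (U.Omega H), IsInternal S → S ⊆ ⋃ i < n, T i →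
      loebPre H S ≤ ∑ i ∈ Finset.range n, loebPre H (T i) := by
  induction n with
  | zero =>
    intro S _ hS
    have : S = ∅ := by simpa using hS
    simp [this, loebPre_empty hH]
  | succ n ih =>
    intro S hS hST
    rw [← loebPre_inter_add_diff hH.1 hS (hT n), Finset.sum_range_succ, add_comm]
    refine add_le_add (ih _ (hS.diff (hT n)) ?_)
      (loebPre_mono hH.1 (hS.inter (hT n)) (hT n) Set.inter_subset_right)
    rintro x ⟨hxS, hxT⟩
    obtain ⟨i, hi, hx⟩ := Set.mem_iUnion₂.1 (hST hxS)
    refine Set.mem_iUnion₂.2 ⟨i, lt_of_le_of_ne (Nat.lt_succ_iff.1 hi) ?_, hx⟩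
    rintro rfl
    exact hxT hx

theorem IsSaturated.sInter_nonempty (hsat : U.IsSaturated 𝔠) (hH : H ∈ U.starNat)
    {F : Set (Set (U.Omega H))} (hF : ∀ S ∈ F, IsInternal S) (hcard : #F < 𝔠) (hfip : HasFIP F) :
    (⋂₀ F).Nonempty := by
  classical
  -- Adding `Set.univ` forces the point given by saturation to lie in `Ω`, even when `F` is empty.
  have hF' : ∀ S ∈ insert Set.univ F, IsInternal S := by
    rintro S (rfl | hS)
    exacts [isInternal_univ hH, hF S hS]
  have hF'' : ∀ S : Set (U.Omega H), ∃ a, S ∈ insert Set.univ F →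
      a ∈ U.starV ∧ {x | x ε a} = Omega.val '' S := by
    intro S
    by_cases hS : S ∈ insert Set.univ F
    · obtain ⟨a, h, ha, haS⟩ := hF' S hS
      exact ⟨a, fun _ => ⟨ha.mem_starV, haS⟩⟩
    · exact ⟨H, fun h => (hS h).elim⟩
  choose g hg using hF''
  have hmem : ∀ S ∈ insert Set.univ F, ∀ x, x ε g S ↔ ∃ y ∈ S, y.val = x :=
    fun S hS x => Set.ext_iff.1 (hg S hS).2 x
  have hlt : #(g '' insert Set.univ F) < 𝔠 :=
    (mk_image_le.trans (mk_insert_le)).trans_lt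
      (add_lt_of_lt aleph0_le_continuum hcard (one_lt_aleph0.trans_le aleph0_le_continuum))
  have hex : ∃ x ∈ U.starV, ∀ a ∈ g '' insert Set.univ F, x ε a := by
    refine hsat (g '' insert Set.univ F) ?_ hlt ?_
    · rintro _ ⟨S, hS, rfl⟩
      exact (hg S hS).1
    · intro G hG hGfin
      obtain ⟨G', hG', hGfin', rfl⟩ := (Set.exists_subset_image_finite_and (p := fun t => t = G)).1
        ⟨G, hG, hGfin, rfl⟩
      obtain ⟨y, hy⟩ := hfip (G' \ {Set.univ}) (fun S hS => (hG' hS.1).resolve_left hS.2)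
        hGfin'.sdiff
      refine ⟨y.val, ⟨0, y.2.1⟩, ?_⟩
      rintro _ ⟨S, hS, rfl⟩
      refine (hmem S (hG' hS) _).2 ⟨y, ?_, rfl⟩
      by_cases h : S = Set.univ
      · exact h ▸ trivial
      · exact hy S ⟨hS, h⟩
  obtain ⟨x, -, hx⟩ := hex
  obtain ⟨y, -, rfl⟩ := (hmem _ (Set.mem_insert _ _) x).1 (hx _ ⟨_, Set.mem_insert _ _, rfl⟩)
  refine ⟨y, fun S hS => ?_⟩
  have hS' := Set.mem_insert_of_mem Set.univ hS
  obtain ⟨z, hz, hzy⟩ := (hmem S hS' _).1 (hx _ ⟨S, hS', rfl⟩)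
  exact Omega.val_injective hzy ▸ hz

/-- Saturation makes internal sets countably compact: if no finite subfamily covered `S`, the sets
`S \ T i` would have a common point. So finite subadditivity suffices; a non-internal `T i`
contributes `∞`. -/
theorem loebPre_le_tsum (hsat : U.IsSaturated 𝔠) (hH : U.IsHyperfinite H) (hS : IsInternal S)
    (T : ℕ → Set (U.Omega H)) (hST : S ⊆ ⋃ i, T i) : loebPre H S ≤ ∑' i, loebPre H (T i) := by
  by_cases hT : ∀ i, IsInternal (T i)
  swap
  · push Not at hT
    obtain ⟨i, hi⟩ := hT
    rw [ENNReal.tsum_eq_top_of_eq_top ⟨i, ?_⟩]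
    · exact le_top
    · by_contra h
      exact hi (isInternal_of_loebPre_ne_top h)
  have hfin : ∃ n, S ⊆ ⋃ i < n, T i := by
    by_contra! hcon
    suffices h : (⋂₀ Set.range fun i => S \ T i).Nonempty by
      obtain ⟨x, hx⟩ := h
      have hx' : ∀ i, x ∈ S \ T i := fun i => hx _ ⟨i, rfl⟩
      obtain ⟨i, hi⟩ := Set.mem_iUnion.1 (hST (hx' 0).1)
      exact (hx' i).2 hi
    refine hsat.sInter_nonempty hH.1 ?_ ?_ ?_
    · rintro _ ⟨i, rfl⟩
      exact hS.diff (hT i)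
    · exact (le_aleph0_iff_set_countable.2 (Set.countable_range _)).trans_lt aleph0_lt_continuum
    · intro G hG hGfin
      rw [← Set.image_univ] at hG
      obtain ⟨G', -, hG', rfl⟩ := (Set.exists_subset_image_finite_and (p := fun t => t = G)).1
        ⟨G, hG, hGfin, rfl⟩
      obtain ⟨n, hn⟩ := hG'.bddAbove
      obtain ⟨x, hxS, hxT⟩ := Set.not_subset.1 (hcon (n + 1))
      refine ⟨x, ?_⟩
      rintro _ ⟨i, hi, rfl⟩
      exact ⟨hxS, fun hx => hxT (Set.mem_iUnion₂.2 ⟨i, Nat.lt_succ_of_le (hn hi), hx⟩)⟩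
  obtain ⟨n, hn⟩ := hfin
  exact (loebPre_le_sum hH T hT n S hS hn).trans (ENNReal.sum_le_tsum _)

theorem loebOuter_eq (hsat : U.IsSaturated 𝔠) (hH : U.IsHyperfinite H) (hS : IsInternal S) :
    loebOuter H S = loebPre H S := by
  apply le_antisymm (OuterMeasure.boundedBy_le S)
  rw [OuterMeasure.boundedBy_eq_ofFunction (loebPre_empty hH)]
  exact le_iInf fun T => le_iInf fun hT => loebPre_le_tsum hsat hH hS T hT

theorem IsInternal.measurableSet (hH : H ∈ U.starNat) (hS : IsInternal S) : MeasurableSet S := by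
  refine OuterMeasure.boundedBy_caratheodory fun T => ?_
  by_cases hT : loebPre H T = ⊤
  · exact hT ▸ le_top
  · exact (loebPre_inter_add_diff hH (isInternal_of_loebPre_ne_top hT) hS).le

theorem loebMeasure_eq_outer (hS : MeasurableSet S) : loebMeasure H S = loebOuter H S :=
  toMeasure_apply _ _ hS

theorem loebMeasure_eq (hsat : U.IsSaturated 𝔠) (hH : U.IsHyperfinite H) (hS : IsInternal S) :
    loebMeasure H S = loebPre H S := by
  rw [loebMeasure_eq_outer (hS.measurableSet hH.1), loebOuter_eq hsat hH hS]

theorem isProbabilityMeasure_loebMeasure (hsat : U.IsSaturated 𝔠) (hH : U.IsHyperfinite H) :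
    IsProbabilityMeasure (loebMeasure H) :=
  ⟨by rw [loebMeasure_eq hsat hH (isInternal_univ hH.1), loebPre_univ hH]⟩

/-- Inner regularity of the Loeb measure with respect to countable intersections of internal
sets. -/
theorem exists_iInter_internal_subset (hsat : U.IsSaturated 𝔠) (hH : U.IsHyperfinite H)
    (hS : MeasurableSet S) {e : ENNReal} (he : e ≠ 0) :
    ∃ T : ℕ → Set (U.Omega H), (∀ i, IsInternal (T i)) ∧ ⋂ i, T i ⊆ S ∧
      loebMeasure H S ≤ loebMeasure H (⋂ i, T i) + e := by
  have := isProbabilityMeasure_loebMeasure hsat hH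
  -- Cover the complement of `S` by internal sets of almost minimal total premeasure; the
  -- complements of these are the required sets.
  have hlt : loebOuter H Sᶜ < loebMeasure H Sᶜ + e := by
    rw [← loebMeasure_eq_outer hS.compl]
    exact ENNReal.lt_add_right (measure_ne_top _ _) he
  rw [show loebOuter H = OuterMeasure.boundedBy (loebPre H) from rfl,
    OuterMeasure.boundedBy_eq_ofFunction (loebPre_empty hH),
    OuterMeasure.ofFunction_apply] at hlt
  simp only [iInf_lt_iff] at hlt
  obtain ⟨T, hT, hlt⟩ := hlt
  have hint : ∀ i, IsInternal (T i) := fun i => isInternal_of_loebPre_ne_top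
    (ENNReal.ne_top_of_tsum_ne_top (hlt.trans_le le_top).ne i)
  have hint' : ∀ i, IsInternal (T i)ᶜ := fun i => (hint i).compl hH.1
  have hTm : MeasurableSet (⋃ i, T i) := .iUnion fun i => (hint i).measurableSet hH.1
  have hle : loebMeasure H (⋃ i, T i) ≤ loebMeasure H Sᶜ + e := by
    refine ((measure_iUnion_le _).trans (le_of_eq ?_)).trans hlt.le
    simp_rw [loebMeasure_eq hsat hH (hint _)]
  refine ⟨fun i => (T i)ᶜ, hint', ?_, ?_⟩
  · rw [← Set.compl_iUnion]
    exact Set.compl_subset_comm.1 hT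
  · rw [← Set.compl_iUnion]
    have h₁ := prob_add_prob_compl (μ := loebMeasure H) hS
    have h₂ := prob_add_prob_compl (μ := loebMeasure H) hTm
    refine ENNReal.le_of_add_le_add_right (measure_ne_top (loebMeasure H) Sᶜ) ?_
    rw [h₁, ← h₂, add_comm (loebMeasure H (⋃ i, T i)), add_assoc]
    rw [add_comm e]
    gcongr

end NonstandardUniverse

/-! ### Densities of periodic sets and the digit map -/

open Filter Topology in
theorem Nat.tendsto_card_filter_div_of_periodic {p : ℕ → Prop} [DecidablePred p] {N : ℕ}
    (hN : 0 < N) (hp : Function.Periodic p N) :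
    Tendsto (fun n : ℕ => (((Finset.Icc 1 n).filter p).card : ℝ) / n) atTop
      (𝓝 ((Nat.count p N : ℝ) / N)) := by
  set f : ℕ → ℕ := fun n => ((Finset.Icc 1 n).filter p).card with hf
  set c := Nat.count p N with hc
  have hadd : ∀ n, f (n + N) = f n + c := by
    intro n
    rw [hc, ← Nat.filter_Ico_card_eq_of_periodic (n + 1) N p hp]
    have : Finset.Icc 1 (n + N) = Finset.Icc 1 n ∪ Finset.Ico (n + 1) (n + 1 + N) := by
      ext k
      simp only [Finset.mem_union, Finset.mem_Icc, Finset.mem_Ico]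
      omega
    simp only [hf]
    rw [this, Finset.filter_union, Finset.card_union_of_disjoint]
    refine Finset.disjoint_filter_filter ?_
    rw [Finset.disjoint_left]
    intro k hk hk'
    simp only [Finset.mem_Icc, Finset.mem_Ico] at hk hk'
    omega
  -- The error `N * f n - c * n` is `N`-periodic by `hadd`, hence bounded; division by `n * N`
  -- leaves at most `c / n`.
  have hbound : ∀ n, c * n ≤ N * f n + c * N ∧ N * f n ≤ c * n + c * N := by
    intro n
    induction n using Nat.strong_induction_on with
    | _ n ih =>
      rcases lt_or_ge n N with hn | hn
      · have h₁ : f n ≤ f N :=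
          Finset.card_le_card (Finset.filter_subset_filter _ (Finset.Icc_subset_Icc_right hn.le))
        have h₂ : f N = c := by
          have := hadd 0
          rw [zero_add] at this
          rw [this]
          simp [hf]
        constructor
        · nlinarith
        · nlinarith
      · obtain ⟨m, rfl⟩ := Nat.exists_eq_add_of_le' hn
        obtain ⟨h₁, h₂⟩ := ih m (by omega)
        rw [hadd]
        constructor <;> nlinarith
  have hlim : Tendsto (fun n : ℕ => (c : ℝ) / n) atTop (𝓝 0) :=
    tendsto_const_div_atTop_nhds_zero_nat _
  rw [tendsto_iff_dist_tendsto_zero]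
  refine squeeze_zero' (Eventually.of_forall fun _ => dist_nonneg) ?_ hlim
  filter_upwards [eventually_gt_atTop 0] with n hn
  obtain ⟨h₁, h₂⟩ := hbound n
  have hn' : (0 : ℝ) < n := by exact_mod_cast hn
  have hN' : (0 : ℝ) < N := by exact_mod_cast hN
  have h₁' : (c : ℝ) * n ≤ N * f n + c * N := by exact_mod_cast h₁
  have h₂' : (N : ℝ) * f n ≤ c * n + c * N := by exact_mod_cast h₂
  rw [Real.dist_eq, div_sub_div _ _ hn'.ne' hN'.ne', abs_div, abs_of_pos (mul_pos hn' hN'),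
    div_le_div_iff₀ (mul_pos hn' hN') hn', ← mul_assoc, mul_right_comm]
  refine mul_le_mul_of_nonneg_right (abs_le.2 ⟨?_, ?_⟩) hn'.le <;> linarith

/-- Binary expansion is a bijection from the numbers below `2 ^ n` to `Fin n → Bool`, which turns
the count into that of a product set. -/
theorem Nat.count_testBit (n : ℕ) (t : ℕ → Finset Bool) :
    Nat.count (fun k => ∀ i < n, k.testBit i ∈ t i) (2 ^ n) =
      ∏ i ∈ Finset.range n, (t i).card := by
  rw [Nat.count_eq_card_filter_range, Finset.card_filter,
    ← Fin.sum_univ_eq_sum_range (fun k => if ∀ i < n, k.testBit i ∈ t i then 1 else 0),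
    ← Finset.card_filter, ← Fin.prod_univ_eq_prod_range (fun i => (t i).card),
    ← Fintype.card_piFinset]
  let e : Fin (2 ^ n) → Fin n → Bool := fun k i => (k : ℕ).testBit i
  have he : Function.Bijective e := by
    rw [Fintype.bijective_iff_injective_and_card]
    refine ⟨fun k l h => Fin.ext (Nat.eq_of_testBit_eq fun i => ?_), by simp⟩
    rcases lt_or_ge i n with hi | hi
    · exact congrFun h ⟨i, hi⟩
    · have h2 : 2 ^ n ≤ 2 ^ i := Nat.pow_le_pow_right two_pos hi
      rw [Nat.testBit_lt_two_pow (k.2.trans_le h2), Nat.testBit_lt_two_pow (l.2.trans_le h2)]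
  refine Finset.card_bijective e he fun k => ?_
  simp only [Finset.mem_filter, Finset.mem_univ, true_and, Fintype.mem_piFinset]
  exact ⟨fun h i => h i i.2, fun h i hi => h ⟨i, hi⟩⟩

instance : IsProbabilityMeasure cantorMeasure := by
  unfold cantorMeasure
  infer_instance

namespace NonstandardUniverse

open StdV

variable {U : NonstandardUniverse.{u}} {H : U.Carrier}

open Classical in
/-- The binary digits of a point of `Ω`, of standard index. -/
noncomputable def Omega.bits (x : U.Omega H) (i : ℕ) : Bool :=
  decide (x.val ε U.star (natSet {k | k.testBit i}))

/-- `T` is one of four sets, and `*` respects complements. -/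
theorem Omega.bits_mem_iff (x : U.Omega H) (i : ℕ) (T : Set Bool) :
    x.bits i ∈ T ↔ x.val ε U.star (natSet {k | k.testBit i ∈ T}) := by
  have huniv : x.val ε U.star (natSet Set.univ) := elem_star_natSet_univ x.val_mem
  have hbits : x.bits i = true ↔ x.val ε U.star (natSet {k | k.testBit i}) := by
    simp [Omega.bits]
  by_cases h₁ : true ∈ T <;> by_cases h₂ : false ∈ T
  · have hT : T = Set.univ := Set.eq_univ_of_forall (by rintro (_ | _) <;> assumption)
    simpa [hT] using huniv
  · have hT : T = {true} := by ext (_ | _) <;> simp [h₁, h₂]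
    simpa [hT] using hbits
  · have hT : T = {false} := by ext (_ | _) <;> simp [h₁, h₂]
    have : {k : ℕ | k.testBit i ∈ T} = {k | k.testBit i}ᶜ := by ext k; simp [hT]
    rw [this, elem_star_natSet_compl _ x.val_mem, ← hbits]
    simp [hT]
  · have hT : T = ∅ := Set.eq_empty_of_forall_notMem (by rintro (_ | _) <;> assumption)
    have : {k : ℕ | k.testBit i ∈ T} = Set.univᶜ := by ext k; simp [hT]
    rw [this, elem_star_natSet_compl _ x.val_mem]
    simpa [hT] using huniv

theorem Omega.forall_bits_mem_iff (x : U.Omega H) (n : ℕ) (t : ℕ → Set Bool) :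
    (∀ i < n, x.bits i ∈ t i) ↔ x.val ε U.star (natSet {k | ∀ i < n, k.testBit i ∈ t i}) := by
  induction n with
  | zero => simpa using elem_star_natSet_univ x.val_mem
  | succ n ih =>
    have : {k : ℕ | ∀ i < n + 1, k.testBit i ∈ t i} =
        {k | ∀ i < n, k.testBit i ∈ t i} ∩ {k | k.testBit n ∈ t n} := by
      ext k
      exact Nat.forall_lt_succ_right
    rw [this, elem_star_natSet_inter, ← ih, ← Omega.bits_mem_iff, Nat.forall_lt_succ_right]

theorem isInternal_bits_mem (hH : H ∈ U.starNat) (i : ℕ) (T : Set Bool) :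
    IsInternal {x : U.Omega H | x.bits i ∈ T} := by
  simp only [Omega.bits_mem_iff]
  exact isInternal_elem_star hH _

theorem measurable_bits (hH : H ∈ U.starNat) :
    Measurable (Omega.bits : U.Omega H → ℕ → Bool) :=
  measurable_pi_iff.2 fun i _ _ => (isInternal_bits_mem hH i _).measurableSet hH

/-- The digits of a point of `Ω` are independent fair coins. -/
theorem map_bits_loebMeasure (hsat : U.IsSaturated 𝔠) (hH : U.IsHyperfinite H) :
    (loebMeasure H).map Omega.bits = cantorMeasure := by
  classical
  refine Measure.eq_infinitePi _ fun s t _ => ?_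
  rw [Measure.map_apply (measurable_bits hH.1)
    (MeasurableSet.pi s.countable_toSet fun i _ => (Set.toFinite (t i)).measurableSet)]
  obtain ⟨n, hn⟩ : ∃ n, s ⊆ Finset.range n := s.exists_nat_subset_range
  -- Padding with `Set.univ` turns a condition on the digits in `s` into one on an initial block,
  -- without changing the product of the measures.
  set t' : ℕ → Set Bool := fun i => if i ∈ s then t i else Set.univ with ht'
  have hpre : Omega.bits ⁻¹' (Set.pi s t) =
      {x : U.Omega H | x.val ε U.star (natSet {k | ∀ i < n, k.testBit i ∈ t' i})} := by
    ext x
    refine Iff.trans ?_ (x.forall_bits_mem_iff n t')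
    simp only [ht', Set.mem_preimage, Set.mem_pi, Finset.mem_coe]
    constructor
    · intro h i _
      split_ifs with hi
      exacts [h i hi, trivial]
    · intro h i hi
      simpa [hi] using h i (Finset.mem_range.1 (hn hi))
  have hprod : ∏ i ∈ s, (PMF.uniformOfFintype Bool).toMeasure (t i) =
      ∏ i ∈ Finset.range n, (PMF.uniformOfFintype Bool).toMeasure (t' i) := by
    rw [← Finset.prod_subset hn fun i _ hi => by
      rw [show t' i = Set.univ from if_neg hi, measure_univ]]
    exact Finset.prod_congr rfl fun i hi => by simp [ht', hi]
  have hint : IsInternal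
      {x : U.Omega H | x.val ε U.star (natSet {k | ∀ i < n, k.testBit i ∈ t' i})} :=
    isInternal_elem_star hH.1 _
  -- Adding `2 ^ n` leaves the digits below `n` unchanged.
  have hper : Function.Periodic (fun k : ℕ => ∀ i < n, k.testBit i ∈ (t' i).toFinset) (2 ^ n) := by
    intro k
    refine forall_congr fun i => forall_congr fun hi => ?_
    rw [add_comm, Nat.testBit_two_pow_add_gt hi]
  have hdens := Nat.tendsto_card_filter_div_of_periodic (Nat.two_pow_pos n) hper
  rw [Nat.count_testBit] at hdens
  have hset : {k : ℕ | ∀ i < n, k.testBit i ∈ t' i} =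
      {k | ∀ i < n, k.testBit i ∈ (t' i).toFinset} := by
    simp only [Set.mem_toFinset]
  rw [hpre, loebMeasure_eq hsat hH hint, hprod, hset,
    loebPre_of_density hH
      (d := ((∏ i ∈ Finset.range n, (t' i).toFinset.card : ℕ) : ℝ) / (2 ^ n : ℕ))
      (by convert hdens; exact Set.mem_ofPred_eq ▸ Iff.rfl)]
  have : ((∏ i ∈ Finset.range n, (t' i).toFinset.card : ℕ) : ℝ) / (2 ^ n : ℕ) =
      ∏ i ∈ Finset.range n, ((t' i).toFinset.card : ℝ) / 2 := by
    rw [Finset.prod_div_distrib]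
    simp
  rw [this, ENNReal.ofReal_prod_of_nonneg fun _ _ => by positivity]
  refine Finset.prod_congr rfl fun i _ => ?_
  rw [PMF.toMeasure_uniformOfFintype_apply _ (Set.toFinite _).measurableSet,
    ENNReal.ofReal_div_of_pos two_pos]
  simp

end NonstandardUniverse

/-! ### Counting, and the compact family -/

/-- A well-order whose type is the initial ordinal of `𝔠`. -/
theorem exists_wellOrder_continuum (X : Type*) (hX : #X = 𝔠) :
    ∃ r : X → X → Prop, (∀ x y, ¬ r x y → x = y ∨ r y x) ∧ ∀ y, #{x | r x y} < 𝔠 := by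
  obtain ⟨r, wo, hr⟩ := Cardinal.exists_ord_eq X
  refine ⟨r, fun x y h => ?_, fun y => ?_⟩
  · rcases trichotomous_of r x y with h' | h' | h'
    exacts [(h h').elim, Or.inl h', Or.inr h']
  · rw [← hX]
    exact (Ordinal.card_typein y).symm.trans_lt (Cardinal.card_typein_lt y hr)

/-- Outer regularity: take the complement of a small open set containing `S`. -/
theorem exists_isClosed_disjoint_cantorMeasure {S : Set (ℕ → Bool)} (hS : cantorMeasure S = 0)
    {e : ENNReal} (he : e ≠ 0) :
    ∃ P : Set (ℕ → Bool), IsClosed P ∧ Disjoint P S ∧ cantorMeasure Pᶜ ≤ e := by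
  obtain ⟨V, hSV, hV, hVe⟩ := Set.exists_isOpen_lt_of_lt S e (hS ▸ pos_iff_ne_zero.2 he)
  exact ⟨Vᶜ, hV.isClosed_compl, Set.disjoint_compl_left_iff_subset.2 hSV, by simpa using hVe.le⟩

namespace NonstandardUniverse

variable {U : NonstandardUniverse.{u}} {H : U.Carrier}

theorem mk_isInternal_le (H : U.Carrier) : #{S : Set (U.Omega H) // IsInternal S} ≤ #U.starNat := by
  obtain ⟨g, hg, hginj⟩ := exists_internal_code (U := U)
  have hex : ∀ S : {S : Set (U.Omega H) // IsInternal S}, ∃ a h, U.IsInternalCard a h ∧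
    {x | x ε a} = Omega.val '' S.1 := fun S => S.2
  choose a h ha haS using hex
  refine mk_le_of_injective (f := fun S => (⟨g (a S), hg _ _ (ha S)⟩ : U.starNat)) fun S T hST => ?_
  have : a S = a T := hginj _ _ _ _ (ha S) (ha T) (congrArg Subtype.val hST)
  refine Subtype.ext (Omega.val_injective.image_injective ?_)
  change Omega.val '' S.1 = Omega.val '' T.1
  rw [← haS, ← haS, this]

theorem mk_seq_isInternal_le (hcard : #U.starNat = 𝔠) :
    #((ℕ → {S : Set (U.Omega H) // IsInternal S}) × ℕ) ≤ 𝔠 := by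
  have h : #(ℕ → {S : Set (U.Omega H) // IsInternal S}) ≤ 𝔠 := by
    rw [mk_arrow, lift_uzero, mk_nat, lift_aleph0]
    exact (power_le_power_right ((mk_isInternal_le H).trans_eq hcard)).trans_eq
      continuum_power_aleph0
  rw [mk_prod, lift_uzero, mk_nat, lift_aleph0]
  exact (mul_le_mul' h le_rfl).trans_eq continuum_mul_aleph0

/-- Given fewer than `𝔠` sequences of internal sets from an ultrafilter, some point lies in all of
the sets and its digits are the limit of the digits along the ultrafilter. -/
theorem exists_mem_of_ultrafilter (hsat : U.IsSaturated 𝔠) (hH : H ∈ U.starNat)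
    (F : Ultrafilter (U.Omega H)) {ι : Type u} (hι : #ι < 𝔠) (T : ι → ℕ → Set (U.Omega H))
    (hT : ∀ d i, IsInternal (T d i)) (hTF : ∀ d i, T d i ∈ F) :
    ∃ x, x.bits = (F.map Omega.bits).lim ∧ ∀ d i, x ∈ T d i := by
  set p := (F.map Omega.bits).lim with hp
  have hlim : ↑(F.map Omega.bits) ≤ nhds p := Ultrafilter.le_nhds_lim _
  -- Fixing one coordinate is an open condition on `2^ω`, so convergence to `p` puts it in `F`.
  -- These are countably many further internal sets for saturation.
  have hbits : ∀ i, {x : U.Omega H | x.bits i ∈ ({p i} : Set Bool)} ∈ F := by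
    intro i
    have hopen : IsOpen ((fun y : ℕ → Bool => y i) ⁻¹' {p i}) :=
      (isOpen_discrete _).preimage (continuous_apply i)
    exact hlim (hopen.mem_nhds rfl)
  let A : Set (Set (U.Omega H)) := Set.range fun d : ι × ℕ => T d.1 d.2
  let B : Set (Set (U.Omega H)) := Set.range fun i => {x : U.Omega H | x.bits i ∈ ({p i} : Set Bool)}
  have hA : #A < 𝔠 := by
    refine mk_range_le.trans_lt ?_
    rw [mk_prod, lift_uzero, mk_nat, lift_aleph0]
    exact mul_lt_of_lt aleph0_le_continuum hι aleph0_lt_continuum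
  have hB : #B < 𝔠 :=
    (le_aleph0_iff_set_countable.2 (Set.countable_range _)).trans_lt aleph0_lt_continuum
  have hAB : ∀ S ∈ A ∪ B, S ∈ F := by
    rintro _ (⟨⟨d, i⟩, rfl⟩ | ⟨i, rfl⟩)
    exacts [hTF d i, hbits i]
  obtain ⟨x, hx⟩ := hsat.sInter_nonempty hH (F := A ∪ B)
    (by
      rintro _ (⟨⟨d, i⟩, rfl⟩ | ⟨i, rfl⟩)
      exacts [hT d i, isInternal_bits_mem hH i _])
    ((mk_union_le A B).trans_lt (add_lt_of_lt aleph0_le_continuum hA hB))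
    (fun G hG hGfin => F.nonempty_of_mem
      ((Filter.sInter_mem hGfin).2 fun S hS => hAB S (hG hS)))
  exact ⟨x, funext fun i => hx _ (Or.inr ⟨i, rfl⟩), fun d i => hx _ (Or.inl ⟨(d, i), rfl⟩)⟩

/-- A family of countable intersections of internal sets, each one cut down by the preimage of a
closed set of digit sequences, is compact if each digit sequence belongs to fewer than `𝔠` of the
closed sets. -/
theorem isCompactFamily_range (hsat : U.IsSaturated 𝔠) (hH : H ∈ U.starNat) {I : Type u}
    (T : I → ℕ → Set (U.Omega H)) (hT : ∀ d i, IsInternal (T d i)) (P : I → Set (ℕ → Bool))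
    (hP : ∀ d, IsClosed (P d)) (hlt : ∀ y, #{d | y ∈ P d} < 𝔠) :
    IsCompactFamily (Set.range fun d => (⋂ i, T d i) ∩ Omega.bits ⁻¹' P d) := by
  intro D hD hfip
  have hne : (Filter.generate D).NeBot := Filter.generate_neBot_iff.2 hfip
  let F := Ultrafilter.of (Filter.generate D)
  have hDF : ∀ S ∈ D, S ∈ F := fun S hS =>
    Ultrafilter.of_le (Filter.generate D) (Filter.mem_generate_of_mem hS)
  let p := (F.map Omega.bits).lim
  let J : Set I := {d | (⋂ i, T d i) ∩ Omega.bits ⁻¹' P d ∈ D}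
  have hlim : Filter.Tendsto Omega.bits (F : Filter (U.Omega H)) (nhds p) :=
    Ultrafilter.le_nhds_lim (F.map Omega.bits)
  have hp : ∀ d ∈ J, p ∈ P d := fun d hd => by
    have hd' : Omega.bits ⁻¹' P d ∈ F := Filter.mem_of_superset (hDF _ hd) Set.inter_subset_right
    exact (hP d).mem_of_tendsto hlim hd'
  -- The subfamily `D` is arbitrary; the common limit `p` is what makes it small enough for
  -- saturation.
  have hJ : #J < 𝔠 := (mk_le_mk_of_subset hp).trans_lt (hlt p)
  obtain ⟨x, hx, hxT⟩ := exists_mem_of_ultrafilter hsat hH F hJ (fun d => T d.1)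
    (fun d => hT d.1) fun d i => Filter.mem_of_superset (hDF _ d.2)
      (Set.inter_subset_left.trans (Set.iInter_subset _ i))
  refine ⟨x, fun S hS => ?_⟩
  obtain ⟨d, rfl⟩ := hD hS
  refine ⟨Set.mem_iInter.2 (hxT ⟨d, hS⟩), ?_⟩
  change x.bits ∈ P d
  rw [hx]
  exact hp d hS

end NonstandardUniverse

open NonstandardUniverse in
theorem corollary4 (U : NonstandardUniverse.{u})
    (hnull : ∀ S : Set (ℕ → Bool), #S < 𝔠 → cantorMeasure S = 0)
    (hsat : U.IsSaturated 𝔠) (hcard : #U.starNat = 𝔠)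
    (H : U.Carrier) (hH : U.IsHyperfinite H) :
    IsCompactProbabilitySpace (NonstandardUniverse.loebMeasure H) := by
  have hprob := isProbabilityMeasure_loebMeasure hsat hH
  obtain ⟨r, hr, hseg⟩ := exists_wellOrder_continuum (ℕ → Bool) (by simp)
  obtain ⟨j⟩ := lift_mk_le'.1 (show lift.{0} #((ℕ → {S : Set (U.Omega H) // IsInternal S}) × ℕ) ≤
    lift.{u} #(ℕ → Bool) by simpa using mk_seq_isInternal_le hcard)
  -- `P d` avoids the segment below `j d`, null by `hnull`. Its complement has measure at most the
  -- inverse of `d.2`, which is `∞` and harmless when `d.2 = 0`.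
  choose P hPclosed hPdisj hPmeas using
    fun d : (ℕ → {S : Set (U.Omega H) // IsInternal S}) × ℕ =>
      exists_isClosed_disjoint_cantorMeasure (hnull _ (hseg (j d)))
        (ENNReal.inv_ne_zero.2 (ENNReal.natCast_ne_top d.2))
  have hint : ∀ d : (ℕ → {S : Set (U.Omega H) // IsInternal S}) × ℕ, ∀ i, IsInternal (d.1 i).1 :=
    fun d i => (d.1 i).2
  have hlt : ∀ y, #{d | y ∈ P d} < 𝔠 := by
    intro y
    have hsub : j '' {d | y ∈ P d} ⊆ insert y {x | r x y} := by
      rintro _ ⟨d, hd, rfl⟩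
      -- If `y ∈ P d`, then `y` is not below `j d`, so `j d` is `y` or lies below it.
      rcases hr y (j d) fun h => Set.disjoint_left.1 (hPdisj d) hd h with h | h
      exacts [Or.inl h.symm, Or.inr h]
    have h₁ : #(j '' {d | y ∈ P d}) < 𝔠 :=
      ((mk_le_mk_of_subset hsub).trans mk_insert_le).trans_lt
        (add_lt_of_lt aleph0_le_continuum (hseg y) (one_lt_aleph0.trans_le aleph0_le_continuum))
    have h₂ := mk_image_eq_lift j {d | y ∈ P d} j.injective
    rw [lift_uzero] at h₂
    rw [← h₂, ← lift_continuum.{u, 0}]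
    exact lift_lt.2 h₁
  have hmeas : ∀ d, MeasurableSet (Omega.bits (H := H) ⁻¹' P d) := fun d =>
    measurable_bits hH.1 (hPclosed d).measurableSet
  refine ⟨hprob, Set.range fun d => (⋂ i, (d.1 i).1) ∩ Omega.bits ⁻¹' P d, ?_,
    isCompactFamily_range hsat hH.1 _ hint P hPclosed hlt, fun A hA => ⟨?_, fun b hb => ?_⟩⟩
  · rintro _ ⟨d, rfl⟩
    exact (MeasurableSet.iInter fun i => (hint d i).measurableSet hH.1).inter (hmeas d)
  · rintro _ ⟨K, -, hKA, rfl⟩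
    exact measure_mono hKA
  · refine ENNReal.le_of_forall_pos_le_add fun e he _ => ?_
    have he2 : ((e / 2 : NNReal) : ENNReal) ≠ 0 := by simpa using he.ne'
    obtain ⟨T, hT, hTA, hTe⟩ := exists_iInter_internal_subset hsat hH hA he2
    obtain ⟨n, hn⟩ := ENNReal.exists_inv_nat_lt he2
    -- Half of `e` is lost in passing from `A` to the intersection of the `T i`, the other half in
    -- cutting down by `P d`.
    let d : (ℕ → {S : Set (U.Omega H) // IsInternal S}) × ℕ := (fun i => ⟨T i, hT i⟩, n)
    have hK : loebMeasure H ((⋂ i, T i) ∩ Omega.bits ⁻¹' P d) ≤ b :=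
      hb ⟨_, ⟨d, rfl⟩, Set.inter_subset_left.trans hTA, rfl⟩
    have hc : loebMeasure H ((⋂ i, T i) \ Omega.bits ⁻¹' P d) ≤ (e / 2 : NNReal) := by
      refine (measure_mono (t := Omega.bits ⁻¹' (P d)ᶜ) fun x hx => hx.2).trans ?_
      rw [← Measure.map_apply (measurable_bits hH.1) (hPclosed d).measurableSet.compl,
        map_bits_loebMeasure hsat hH]
      exact (hPmeas d).trans hn.le
    calc loebMeasure H A ≤ loebMeasure H (⋂ i, T i) + (e / 2 : NNReal) := hTe
      _ ≤ (b + (e / 2 : NNReal)) + (e / 2 : NNReal) :=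
        add_le_add_left ((measure_le_inter_add_sdiff _ _ _).trans (add_le_add hK hc)) _
      _ = b + e := by rw [add_assoc, ← ENNReal.coe_add, add_halves]
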